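/- Let $N\ge 2$ be an integer, let $\mu$ be the normalized Haar measure on the circle group $\mathbb T$, and let $e_n(z)=z^n$ ($n\in\mathbb Z$). Let $\mathfrak A_N$ be the universal unital $C^*$-algebra generated by $C(\mathbb T)$ and a unitary $U$ with $UfU^{-1}=f(z^N)$ for $f\in C(\mathbb T)$, and let $\mathcal A_N\subset\mathfrak A_N$ be the closed $*$-subalgebra generated by the elements $U^{-i}fU^{i}$, $f\in C(\mathbb T)$, $i=0,1,2,\dots$. Let $\Lambda_N=\mathbb Z[\frac1N]$ as a discrete additive group, let $K_N=\widehat{\Lambda_N}$ be its compact Pontryagin dual, and for $\lambda\in\Lambda_N$ let $e(\lambda)$ be the function $\chi\mapsto\chi(\lambda)$ on $K_N$. (1) $\mathcal A_N$ is abelian, and its Gelfand space is $K_N$: there is a homeomorphism from the character space of $\mathcal A_N$ onto $K_N$, sending $\tau$ to the character $\chi$ with $\chi(n/N^k)=\tau(U^{-k}e_nU^k)$ for all $n\in\mathbb Z$, $k\ge0$. Under it the Gelfand transform is a $*$-isomorphism $\mathcal A_N\cong C(K_N)$; elements of $\mathcal A_N$ are regarded as functions on $K_N$ through it. Let $m_0\in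 L^\infty(\mathbb T)$ be non-singular, i.e. $m_0\neq0$ a.e. (for instance a non-singular wavelet filter), let $$(Rf)(z)=\frac1N\sum_{w^N=z}|m_0(w)|^2f(w),$$ and let $h\in L^1(\mathbb T)$ satisfy $h\ge0$ and $Rh=h$ a.e. (2) There is a unique finite positive Borel measure $\nu=\nu(m_0,h)$ on $K_N$ such that $$\int_{K_N}U^{-i}fU^{i}\,d\nu=\int_{\mathbb T}R^i(fh)\,d\mu\qquad\text{for all } f\in C(\mathbb T),\ i=0,1,2,\dots.$$ (3) The vectors $e(n/N^k)$, $n\in\mathbb Z$, $k\ge0$, span a dense subspace of $L^2(K_N,\nu)$. The $h$-induced representation of $\mathfrak A_N$ is realised on $L^2(K_N,\nu)$ with cyclic vector $\varphi=1$. Here an $h$-induced representation on a Hilbert space $\mathcal H$ is a $*$-representation of $\mathfrak A_N$ (whose value at the generator $U$ is again written $U$) with a cyclic vector $\varphi$, whose restriction to $C(\mathbb T)$ extends to a $*$-representation $\pi$ of $L^\infty(\mathbb T)$ with $U\pi(f)=\pi(f(z^N))U$ and $\langle\varphi,\pi(f)\varphi\rangle=\int_{\mathbb T}fh\,d\mu$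 for all $f\in L^\infty(\mathbb T)$, and $U\varphi=\pi(m_0)\varphi$. That is, there is an $h$-induced representation on $L^2(K_N,\nu)$ with $\varphi=1$ such that every $h$-induced representation is unitarily equivalent to it, by a unitary that intertwines the representations of $\mathfrak A_N$ and of $L^\infty(\mathbb T)$ and carries the cyclic vector to $1$; and it is given by $$\pi(e_n)e(\lambda)=e(n+\lambda)\qquad(n\in\mathbb Z,\ \lambda\in\Lambda_N),$$ $$Ue\Big(\frac n{N^{k+1}}\Big)=m_0\cdot e\Big(\frac n{N^k}\Big)=\sum_{j\in\mathbb Z}a_j\,e\Big(j+\frac n{N^k}\Big)\qquad(n\in\mathbb Z,\ k\ge0),$$ $$Ue(0)=m_0=\sum_{j\in\mathbb Z}a_j\,e(j),$$ where $a_j=\int_{\mathbb T}z^{-j}m_0\,d\mu$ are the Fourier coefficients of $m_0$, and $m_0$ is viewed as the function $\chi\mapsto m_0(\chi(1))$ on $K_N$ (well defined $\nu$-a.e.). The series are understood as follows: the finite partial sums over $F\subset\mathbb Z$ converge in $\nu$-measure, unconditionally (along the net of finite sets $F$); the Cesàro means of the symmetric partial sums converge in the norm of $L^2(K_N,\nu)$;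 and if $h$ is essentially bounded or $\sum_j|a_j|<\infty$, the series converge unconditionally in the norm of $L^2(K_N,\nu)$. -/

import Mathlib

open MeasureTheory Filter
open scoped ENNReal ComplexConjugate InnerProductSpace

namespace RuelleRep

noncomputable section

/-! ### The circle, its Haar measure and the transfer operator -/

instance : MeasurableSpace Circle := borel Circle

instance : BorelSpace Circle := ⟨rfl⟩

/-- The normalized Haar measure `μ` on the circle group `𝕋`. -/
def haarT : Measure Circle := Measure.haarMeasure ⊤

instance : IsProbabilityMeasure haarT :=
  ⟨by simpa [haarT] using Measure.haarMeasure_self (K₀ := (⊤ : TopologicalSpace.PositiveCompacts Circle))⟩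

/-- The map `z ↦ z ^ N` of the circle. -/
def powMap (N : ℕ) : C(Circle, Circle) := ⟨fun z => z ^ N, continuous_pow N⟩

/-- The function `e_n(z) = z ^ n` on the circle. -/
def e (n : ℤ) : C(Circle, ℂ) := ⟨fun z => ((z ^ n : Circle) : ℂ),
  continuous_induced_dom.comp (continuous_zpow n)⟩

/-- The transfer operator `(R f)(z) = N⁻¹ ∑_{w ^ N = z} |m₀(w)|² f(w)`
(for `N ≥ 1` the sum has exactly `N` terms). -/
def ruelle (N : ℕ) (m₀ : Circle → ℂ) (f : Circle → ℂ) : Circle → ℂ := fun z =>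
  (N : ℂ)⁻¹ * ∑ᶠ (w : Circle) (_ : w ^ N = z), ((‖m₀ w‖ ^ 2 : ℝ) : ℂ) * f w

/-- The Fourier coefficient `a_j = ∫ z ^ (-j) m₀(z) dμ(z)`. -/
def fourierCoef (m₀ : Circle → ℂ) (j : ℤ) : ℂ := ∫ z, e (-j) z * m₀ z ∂haarT

/-! ### The `C*`-algebra on generators `C(𝕋)` and a unitary `U` with `U f U⁻¹ = f(z ^ N)` -/

/-- A realization of the relation `U f U⁻¹ = f(z ^ N)` in a (nonzero, unital) `C*`-algebra. -/
structure CovPair (N : ℕ) : Type 1 where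
  B : Type
  [cstar : CStarAlgebra B]
  [nontriv : Nontrivial B]
  j : C(Circle, ℂ) →⋆ₐ[ℂ] B
  u : B
  unitary_u : u ∈ unitary B
  cov : ∀ f : C(Circle, ℂ), u * j f * star u = j (f.comp (powMap N))

attribute [instance] CovPair.cstar CovPair.nontriv

/-- The bounded families `(b_p)`, indexed by all realizations `p` of the relation. -/
abbrev Fam (N : ℕ) : Type 1 := lp (fun p : CovPair N => p.B) ∞

instance (N : ℕ) : CStarAlgebra (Fam N) where

/-- The family `(j_p(f))_p`. -/
def famIota (N : ℕ) (f : C(Circle, ℂ)) : Fam N :=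
  ⟨fun p => p.j f, memℓp_infty ⟨‖f‖, by
    rintro _ ⟨p, rfl⟩
    exact NonUnitalStarAlgHom.norm_apply_le p.j f⟩⟩

/-- The family `(u_p)_p`. -/
def famU (N : ℕ) : Fam N :=
  ⟨fun p => p.u, memℓp_infty ⟨1, by
    rintro _ ⟨p, rfl⟩
    exact CStarRing.norm_of_mem_unitary p.unitary_u |>.le⟩⟩

/-- The generators of the universal algebra. -/
def famGen (N : ℕ) : Set (Fam N) := Set.range (famIota N) ∪ {famU N}

/-- The closed `*`-subalgebra generated by the generators. -/
def univSubalgebra (N : ℕ) : StarSubalgebra ℂ (Fam N) :=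
  (StarAlgebra.adjoin ℂ (famGen N)).topologicalClosure

instance (N : ℕ) : IsClosed (univSubalgebra N : Set (Fam N)) :=
  StarSubalgebra.isClosed_topologicalClosure _

theorem famGen_subset (N : ℕ) : famGen N ⊆ (univSubalgebra N : Set (Fam N)) :=
  (StarAlgebra.subset_adjoin ℂ _).trans (StarSubalgebra.le_topologicalClosure _)

/-- `𝔄_N`: the universal `C*`-algebra on generators `f ∈ C(𝕋)` and a unitary `U` with the
relation `U f U⁻¹ = f(z ^ N)`. It is realized as the closed `*`-subalgebra generated by the
generators inside the product of all realizations of the relation; see `universal` below. -/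
def 𝔄 (N : ℕ) : Type 1 := ↥(univSubalgebra N)

instance (N : ℕ) : CStarAlgebra (𝔄 N) := inferInstanceAs (CStarAlgebra ↥(univSubalgebra N))

/-- The `p`-th coordinate of an element of `𝔄_N`. -/
def coord {N : ℕ} (p : CovPair N) : 𝔄 N →⋆ₐ[ℂ] p.B where
  toFun a := (a.1 : Fam N) p
  map_one' := rfl
  map_mul' _ _ := rfl
  map_zero' := rfl
  map_add' _ _ := rfl
  commutes' _ := rfl
  map_star' _ := rfl

theorem coord_ext {N : ℕ} {a b : 𝔄 N} (hab : ∀ p, coord p a = coord p b) : a = b :=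
  Subtype.ext (lp.ext (funext hab))

/-- A function `f ∈ C(𝕋)` as an element of `𝔄_N`. -/
def ι (N : ℕ) : C(Circle, ℂ) →⋆ₐ[ℂ] 𝔄 N where
  toFun f := ⟨famIota N f, famGen_subset N (Or.inl ⟨f, rfl⟩)⟩
  map_one' := coord_ext fun p => map_one p.j
  map_mul' f g := coord_ext fun p => map_mul p.j f g
  map_zero' := coord_ext fun p => map_zero p.j
  map_add' f g := coord_ext fun p => map_add p.j f g
  commutes' c := coord_ext fun p => AlgHomClass.commutes p.j c
  map_star' f := coord_ext fun p => map_star p.j f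

/-- The unitary generator `U` of `𝔄_N`. -/
def U (N : ℕ) : 𝔄 N := ⟨famU N, famGen_subset N (Or.inr rfl)⟩

theorem U_mem_unitary (N : ℕ) : U N ∈ unitary (𝔄 N) :=
  Unitary.mem_iff.mpr ⟨coord_ext fun p => (Unitary.mem_iff.mp p.unitary_u).1,
    coord_ext fun p => (Unitary.mem_iff.mp p.unitary_u).2⟩

theorem U_cov (N : ℕ) (f : C(Circle, ℂ)) :
    U N * ι N f * star (U N) = ι N (f.comp (powMap N)) :=
  coord_ext fun p => p.cov f

/-- The universal property of `𝔄_N`. -/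
theorem universal (N : ℕ) (B : Type) [CStarAlgebra B] (j : C(Circle, ℂ) →⋆ₐ[ℂ] B) (u : B)
    (hu : u ∈ unitary B) (cov : ∀ f, u * j f * star u = j (f.comp (powMap N))) :
    ∃! ρ : 𝔄 N →⋆ₐ[ℂ] B, (∀ f, ρ (ι N f) = j f) ∧ ρ (U N) = u := by
  refine existsUnique_of_exists_of_unique ?_ ?_
  · rcases subsingleton_or_nontrivial B with hB | hB
    · let ρ : 𝔄 N →⋆ₐ[ℂ] B :=
        { toFun := fun _ => 0
          map_one' := Subsingleton.elim _ _
          map_mul' := fun _ _ => Subsingleton.elim _ _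
          map_zero' := rfl
          map_add' := fun _ _ => Subsingleton.elim _ _
          commutes' := fun _ => Subsingleton.elim _ _
          map_star' := fun _ => Subsingleton.elim _ _ }
      exact ⟨ρ, fun _ => Subsingleton.elim _ _, Subsingleton.elim _ _⟩
    · exact ⟨coord (⟨B, j, u, hu, cov⟩ : CovPair N), fun _ => rfl, rfl⟩
  · rintro ρ₁ ρ₂ ⟨h₁, h₁'⟩ ⟨h₂, h₂'⟩
    have c₁ : Continuous ρ₁ := AddMonoidHomClass.continuous_of_bound ρ₁ 1 fun a => by
      simpa using NonUnitalStarAlgHom.norm_apply_le ρ₁ a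
    have c₂ : Continuous ρ₂ := AddMonoidHomClass.continuous_of_bound ρ₂ 1 fun a => by
      simpa using NonUnitalStarAlgHom.norm_apply_le ρ₂ a
    refine StarAlgHom.ext_topologicalClosure (S := StarAlgebra.adjoin ℂ (famGen N)) c₁ c₂ ?_
    refine StarAlgHom.ext_adjoin ?_
    rintro ⟨x, hx⟩ hx'
    rcases hx' with ⟨f, rfl⟩ | rfl
    · exact (h₁ f).trans (h₂ f).symm
    · exact h₁'.trans h₂'.symm

/-- The element `U⁻ⁱ f Uⁱ` of `𝔄_N`. -/
def conjGen (N : ℕ) (i : ℕ) (f : C(Circle, ℂ)) : 𝔄 N := star (U N) ^ i * ι N f * U N ^ i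

/-- `𝒜_N`: the closed `*`-subalgebra of `𝔄_N` generated by the elements `U⁻ⁱ f Uⁱ`. -/
def 𝒜 (N : ℕ) : StarSubalgebra ℂ (𝔄 N) :=
  (StarAlgebra.adjoin ℂ {a | ∃ (i : ℕ) (f : C(Circle, ℂ)), a = conjGen N i f}).topologicalClosure

/-- The element `U⁻ⁱ f Uⁱ` of `𝒜_N`. -/
def gen (N : ℕ) (i : ℕ) (f : C(Circle, ℂ)) : 𝒜 N :=
  ⟨conjGen N i f, StarSubalgebra.le_topologicalClosure _
    (StarAlgebra.subset_adjoin ℂ _ ⟨i, f, rfl⟩)⟩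

/-! ### The discrete group `Λ_N = ℤ[1/N]` and its compact dual `K_N` -/

/-- `Λ_N = ℤ[1/N]`, the subring of `ℚ` generated by `1/N`. A separate type, so that it carries the
discrete topology and not the topology of `ℚ`. -/
def Lam (N : ℕ) : Type := ↥(Subring.closure {((N : ℚ)⁻¹)})

instance (N : ℕ) : CommRing (Lam N) :=
  inferInstanceAs (CommRing ↥(Subring.closure {((N : ℚ)⁻¹)}))

instance (N : ℕ) : TopologicalSpace (Lam N) := ⊥

instance (N : ℕ) : DiscreteTopology (Lam N) := ⟨rfl⟩

theorem frac_mem (N : ℕ) (n : ℤ) (k : ℕ) :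
    (n : ℚ) / (N : ℚ) ^ k ∈ Subring.closure {((N : ℚ)⁻¹)} := by
  rw [div_eq_mul_inv, ← inv_pow]
  exact mul_mem (intCast_mem _ n) (pow_mem (Subring.subset_closure (Set.mem_singleton _)) k)

/-- The element `n / N ^ k` of `Λ_N`. -/
def frac (N : ℕ) (n : ℤ) (k : ℕ) : Lam N := ⟨(n : ℚ) / (N : ℚ) ^ k, frac_mem N n k⟩

/-- `K_N`, the Pontryagin dual of the discrete additive group `Λ_N`. -/
abbrev K (N : ℕ) : Type := PontryaginDual (Multiplicative (Lam N))

instance (N : ℕ) : MeasurableSpace (K N) := borel (K N)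

instance (N : ℕ) : BorelSpace (K N) := ⟨rfl⟩

/-- The value `χ(lam)` of a character at an element of `Λ_N`. -/
def ev {N : ℕ} (χ : K N) (lam : Lam N) : Circle := χ (Multiplicative.ofAdd lam)

/-- The function `e(lam) : χ ↦ χ(lam)` on `K_N`. -/
def eK (N : ℕ) (lam : Lam N) : C(K N, ℂ) :=
  ⟨fun χ => (ev χ lam : ℂ), by
    have h : Continuous fun χ : Multiplicative (Lam N) →ₜ* Circle =>
        χ (Multiplicative.ofAdd lam) := continuous_eval_const _
    exact continuous_induced_dom.comp h⟩

/-- The vector `e(lam)` of `L²(K_N, ν)`. -/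
def eL2 {N : ℕ} (ν : FiniteMeasure (K N)) (lam : Lam N) : Lp ℂ 2 (ν : Measure (K N)) :=
  ContinuousMap.toLp 2 (ν : Measure (K N)) ℂ (eK N lam)

/-- The meaning given to `v = ∑_j a_j e(j + lam)` in `L²(K_N, ν)`, where `a_j` are the Fourier
coefficients of `m₀`. For unbounded `h` the series need not converge in the norm; it always converges
unconditionally in the measure `ν`, its Cesàro means always converge in the norm of `L²(K_N, ν)`, and
if `h` is bounded, or if `∑ |a_j| < ∞`, it converges unconditionally in the norm. -/
structure IsFourierSum {N : ℕ} (m₀ : Circle → ℂ) (h : Circle → ℝ) (ν : FiniteMeasure (K N))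
    (lam : Lam N) (v : Lp ℂ 2 (ν : Measure (K N))) : Prop where
  inMeasure : TendstoInMeasure (ν : Measure (K N))
    (fun (F : Finset ℤ) (χ : K N) => ∑ j ∈ F, fourierCoef m₀ j * eK N ((j : Lam N) + lam) χ) atTop v
  cesaro : Tendsto (fun M : ℕ => (M + 1 : ℂ)⁻¹ • ∑ n ∈ Finset.range (M + 1),
    ∑ j ∈ Finset.Icc (-(n : ℤ)) n, fourierCoef m₀ j • eL2 ν ((j : Lam N) + lam)) atTop (nhds v)
  hasSum : (MemLp h ∞ haarT ∨ Summable fun j : ℤ => ‖fourierCoef m₀ j‖) →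
    HasSum (fun j : ℤ => fourierCoef m₀ j • eL2 ν ((j : Lam N) + lam)) v

/-! ### Representations -/

/-- The algebra `L^∞(𝕋)` (as a set of classes of functions). -/
abbrev LInf : Type := Lp ℂ ∞ haarT

/-- A (unital `*`-)representation of `L^∞(𝕋)` by bounded operators on `H`. -/
structure LInfRep (H : Type*) [NormedAddCommGroup H] [InnerProductSpace ℂ H] [CompleteSpace H] where
  op : LInf →ₗ[ℂ] (H →L[ℂ] H)
  map_one : ∀ f : LInf, (∀ᵐ z ∂haarT, f z = 1) → op f = 1
  map_mul : ∀ f g k : LInf, (∀ᵐ z ∂haarT, k z = f z * g z) → op k = op f * op g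
  map_star : ∀ f g : LInf, (∀ᵐ z ∂haarT, g z = conj (f z)) → op g = star (op f)

/-- `(ρ, π, φ)` is an `h`-induced representation of `𝔄_N`: `ρ` is a representation of `𝔄_N` whose
restriction to `C(𝕋)` extends to the representation `π` of `L^∞(𝕋)`, still subject to the relation
`U π(f) = π(f(z ^ N)) U`, and `φ` is a cyclic vector with `⟨φ, π(f) φ⟩ = ∫ f h dμ` and
`U φ = π(m₀) φ`. -/
structure IsInduced (N : ℕ) (m₀ : LInf) (h : Circle → ℝ) {H : Type*} [NormedAddCommGroup H]
    [InnerProductSpace ℂ H] [CompleteSpace H] (ρ : 𝔄 N →⋆ₐ[ℂ] (H →L[ℂ] H)) (π : LInfRep H)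
    (φ : H) : Prop where
  extends_rep : ∀ f : C(Circle, ℂ), π.op (ContinuousMap.toLp ∞ haarT ℂ f) = ρ (ι N f)
  covariant : ∀ f g : LInf, (∀ᵐ z ∂haarT, g z = f (z ^ N)) → ρ (U N) * π.op f = π.op g * ρ (U N)
  moments : ∀ f : LInf, ⟪φ, π.op f φ⟫_ℂ = ∫ z, f z * (h z : ℂ) ∂haarT
  scaling : ρ (U N) φ = π.op m₀ φ
  cyclic : (Submodule.span ℂ (Set.range fun a : 𝔄 N => ρ a φ)).topologicalClosure = ⊤

end

end RuelleRep

open RuelleRep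

/-! The Gelfand space. The relation gives `U⁻⁽ⁱ⁺¹⁾ f(z ^ N) Uⁱ⁺¹ = U⁻ⁱ f Uⁱ`, so the copies `U⁻ⁱ
C(𝕋) Uⁱ` increase with `i` and `𝒜 N` is commutative (`conjGen_succ_comp`, `𝒜_mul_comm`). The same
identity makes `n / N ^ k ↦ U⁻ᵏ e_n Uᵏ` a well-defined homomorphism into the unitaries (`expHom`),
so a character of `𝒜 N` restricts to a point of `K N`, and is determined by it because the `e_n`
span a dense subspace of `C(𝕋)`. Every point occurs: on `ℓ²(K N)`, with `U` the composition with the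
dual of multiplication by `N`, a point mass is a joint eigenvector of `𝒜 N` (`exists_character`). A
continuous bijection from a compact space to a Hausdorff one is a homeomorphism.

The measure. Duality between the transfer operator and `z ↦ z ^ N` turns `∫ Rⁱ(f h) dμ` into the
integral of `f` against `|m₀⁽ⁱ⁾|² h dμ`, where `m₀⁽ⁱ⁾` is the cocycle. The task is thus to find `ν`
whose image under `χ ↦ χ(1 / N ^ i)` is this measure for each `i`. The equation `R h = h` says
precisely that the prescribed images are compatible (`integral_pow_level_succ`). Lifting each of
them to `K N` by a section and taking a weak limit gives `ν` (`exists_measure`); density of the span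
of the `e(λ)` in `C(K N)` gives uniqueness.

The representation. With `σ` the dual of multiplication by `N`, the cocycle identity shows that
`|m₀(χ(1))|² ν` is carried to `ν` by `σ` (`isWeight_of_level`). Hence `ξ ↦ m₀(χ(1)) · ξ ∘ σ` is
isometric on `L²(ν)`, and it is onto because `m₀` vanishes almost nowhere. In any induced
representation the vectors `U⁻ⁱ π(f) Uⁱ φ` have inner products depending only on `m₀` and `h`
(`inner_levelVec'`). Their closed span is invariant under `U⁻¹` because a nonsingular `m₀` has
bounded approximate inverses, so they are total (`span_levelVec`), and matching these vectors gives
the unitary equivalence.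

The series. The Fourier series of `m₀` converges in `L²(μ)`, hence in `μ`-measure, hence in measure
for the absolutely continuous image of `ν` under `χ ↦ χ(1)`. The Cesàro means are moreover bounded
by the essential supremum of `|m₀|`, since the Fejér kernel is positive with known mass, and bounded
convergence in measure gives norm convergence (`isFourierSum_of_ae`). -/

namespace RuelleRep

noncomputable section

/-! ### Dense spans of characters -/

/-- A family of continuous functions closed under products and conjugation, containing `1` and
separating points, has dense linear span. -/
theorem span_topologicalClosure_eq_top {X κ : Type*} [TopologicalSpace X] [CompactSpace X]
    (v : κ → C(X, ℂ)) (hone : ∃ i, v i = 1) (hmul : ∀ i j, ∃ k, v i * v j = v k)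
    (hstar : ∀ i, ∃ k, star (v i) = v k) (hsep : ∀ x y, x ≠ y → ∃ i, v i x ≠ v i y) :
    (Submodule.span ℂ (Set.range v)).topologicalClosure = ⊤ := by
  let M : Submonoid C(X, ℂ) :=
    { carrier := Set.range v
      one_mem' := hone
      mul_mem' := by
        rintro _ _ ⟨i, rfl⟩ ⟨j, rfl⟩
        obtain ⟨k, hk⟩ := hmul i j
        exact ⟨k, hk.symm⟩ }
  have hs : star (Set.range v) = Set.range v := by
    refine Set.Subset.antisymm ?_ ?_
    · rintro f ⟨i, hi⟩
      obtain ⟨k, hk⟩ := hstar i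
      exact ⟨k, by rw [← hk, hi, star_star]⟩
    · rintro _ ⟨i, rfl⟩
      obtain ⟨k, hk⟩ := hstar i
      exact ⟨k, hk.symm⟩
  have h := ContinuousMap.starSubalgebra_topologicalClosure_eq_top_of_separatesPoints
    (StarAlgebra.adjoin ℂ (Set.range v)) (by
      intro x y hxy
      obtain ⟨i, hi⟩ := hsep x y hxy
      exact ⟨_, ⟨v i, StarAlgebra.subset_adjoin ℂ _ ⟨i, rfl⟩, rfl⟩, hi⟩)
  -- The family is already a submonoid stable under conjugation, so the star algebra of
  -- Stone–Weierstrass is no larger than the linear span.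
  have key : (StarAlgebra.adjoin ℂ (Set.range v) : Set C(X, ℂ)) =
      (Submodule.span ℂ (Set.range v) : Set C(X, ℂ)) := by
    have h1 : (StarAlgebra.adjoin ℂ (Set.range v)).toSubalgebra =
        Algebra.adjoin ℂ (Set.range v) := by
      rw [StarAlgebra.adjoin_toSubalgebra, hs, Set.union_self]
    have h2 := Algebra.adjoin_eq_span ℂ (Set.range v)
    have h3 : Submonoid.closure (Set.range v) = M := Submonoid.closure_eq M
    rw [h3] at h2
    have h4 := congrArg (fun S : Submodule ℂ C(X, ℂ) => (S : Set C(X, ℂ))) h2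
    rw [← h1] at h4
    exact h4
  refine SetLike.coe_injective ?_
  rw [Submodule.topologicalClosure_coe, ← key, ← StarSubalgebra.topologicalClosure_coe, h]
  rfl

/-- Two finite measures agreeing on a family of continuous functions with dense span agree. -/
theorem measure_ext_of_span {X κ : Type*} [TopologicalSpace X] [CompactSpace X]
    [MeasurableSpace X] [BorelSpace X] [HasOuterApproxClosed X] (v : κ → C(X, ℂ))
    (hv : (Submodule.span ℂ (Set.range v)).topologicalClosure = ⊤) (μ ν : Measure X)
    [IsFiniteMeasure μ] [IsFiniteMeasure ν] (h : ∀ i, ∫ x, v i x ∂μ = ∫ x, v i x ∂ν) : μ = ν := by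
  have hint : ∀ (ν : Measure X) [IsFiniteMeasure ν] (f : C(X, ℂ)), Integrable f ν := fun ν _ f =>
    f.continuous.integrable_of_hasCompactSupport (HasCompactSupport.of_compactSpace f)
  have hcont : ∀ (ν : Measure X) [IsFiniteMeasure ν],
      Continuous fun f : C(X, ℂ) => ∫ x, f x ∂ν := fun ν _ => by
    -- Factoring the integral through the bounded inclusion of `C(X)` into `L¹` makes it continuous.
    have : (fun f : C(X, ℂ) => ∫ x, f x ∂ν) =
        fun f => ∫ x, ContinuousMap.toLp 1 ν ℂ f x ∂ν := by
      ext f; exact (integral_congr_ae (ContinuousMap.coeFn_toLp (𝕜 := ℂ) ν f)).symm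
    rw [this]
    exact continuous_integral.comp (ContinuousLinearMap.continuous _)
  have hall : ∀ f : C(X, ℂ), ∫ x, f x ∂μ = ∫ x, f x ∂ν := by
    intro f
    have hf : f ∈ (Submodule.span ℂ (Set.range v)).topologicalClosure := hv ▸ Submodule.mem_top
    refine closure_minimal (s := (Submodule.span ℂ (Set.range v) : Set C(X, ℂ)))
      (t := {f : C(X, ℂ) | ∫ x, f x ∂μ = ∫ x, f x ∂ν}) ?_ (isClosed_eq (hcont μ) (hcont ν)) hf
    intro g hg
    induction hg using Submodule.span_induction with
    | mem x hx => obtain ⟨i, rfl⟩ := hx; exact h i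
    | zero => simp
    | add x y _ _ hx hy =>
      have hx : ∫ t, x t ∂μ = ∫ t, x t ∂ν := hx
      have hy : ∫ t, y t ∂μ = ∫ t, y t ∂ν := hy
      simp [integral_add (hint μ x) (hint μ y), integral_add (hint ν x) (hint ν y), hx, hy]
    | smul a x _ hx =>
      have hx : ∫ t, x t ∂μ = ∫ t, x t ∂ν := hx
      simp [integral_const_mul, hx]
  refine ext_of_forall_integral_eq_of_IsFiniteMeasure fun f => ?_
  have := hall ⟨fun x => (f x : ℂ), Complex.continuous_ofReal.comp f.continuous⟩
  simp only [ContinuousMap.coe_mk, integral_complex_ofReal] at this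
  exact_mod_cast this

/-! ### Unitary operators from Gram matrices -/

theorem denseRange_linearCombination {κ H : Type*} [NormedAddCommGroup H] [InnerProductSpace ℂ H]
    (v : κ → H) (hv : (Submodule.span ℂ (Set.range v)).topologicalClosure = ⊤) :
    DenseRange (Finsupp.linearCombination ℂ v) := by
  rw [DenseRange, ← LinearMap.coe_range, Finsupp.range_linearCombination, dense_iff_closure_eq,
    ← Submodule.topologicalClosure_coe, hv]
  rfl

/-- Two families of vectors with dense span and the same Gram matrix are unitarily equivalent. -/
theorem exists_linearIsometryEquiv_of_gram {κ H₁ H₂ : Type*} [NormedAddCommGroup H₁]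
    [InnerProductSpace ℂ H₁] [CompleteSpace H₁] [NormedAddCommGroup H₂] [InnerProductSpace ℂ H₂]
    [CompleteSpace H₂] (v : κ → H₁) (w : κ → H₂)
    (hv : (Submodule.span ℂ (Set.range v)).topologicalClosure = ⊤)
    (hw : (Submodule.span ℂ (Set.range w)).topologicalClosure = ⊤)
    (h : ∀ i j, ⟪v i, v j⟫_ℂ = ⟪w i, w j⟫_ℂ) :
    ∃ W : H₁ ≃ₗᵢ[ℂ] H₂, ∀ i, W (v i) = w i := by
  -- Equal Gram matrices give equal norms to the same formal combination; the unitary is then the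
  -- extension of the identity of `κ →₀ ℂ`.
  have hnorm : ∀ x : κ →₀ ℂ,
      ‖Finsupp.linearCombination ℂ w x‖ = ‖Finsupp.linearCombination ℂ v x‖ := by
    intro x
    have : ⟪Finsupp.linearCombination ℂ w x, Finsupp.linearCombination ℂ w x⟫_ℂ =
        ⟪Finsupp.linearCombination ℂ v x, Finsupp.linearCombination ℂ v x⟫_ℂ := by
      simp only [Finsupp.linearCombination_apply, Finsupp.sum, sum_inner, inner_sum,
        inner_smul_left, inner_smul_right, h]
    rw [inner_self_eq_norm_sq_to_K, inner_self_eq_norm_sq_to_K] at this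
    have h2 : ‖Finsupp.linearCombination ℂ w x‖ ^ 2 = ‖Finsupp.linearCombination ℂ v x‖ ^ 2 := by
      exact_mod_cast this
    exact (sq_eq_sq₀ (norm_nonneg _) (norm_nonneg _)).mp h2
  refine ⟨LinearEquiv.extendOfIsometry (LinearEquiv.refl ℂ (κ →₀ ℂ))
    (Finsupp.linearCombination ℂ v) (Finsupp.linearCombination ℂ w) (denseRange_linearCombination v hv)
    (denseRange_linearCombination w hw) hnorm, fun i => ?_⟩
  have := LinearEquiv.extendOfIsometry_eq (LinearEquiv.refl ℂ (κ →₀ ℂ))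
    (Finsupp.linearCombination ℂ v) (Finsupp.linearCombination ℂ w) (denseRange_linearCombination v hv)
    (denseRange_linearCombination w hw) hnorm (Finsupp.single i 1)
  simpa using this

/-! ### Multiplication operators and weighted composition operators on `L²` -/

section Operators

variable {X : Type*} [MeasurableSpace X] {ν : Measure X}

/-- Multiplication by an essentially bounded function on `L²`. -/
def mulFn (g : X → ℂ) (hg : MemLp g ∞ ν) : Lp ℂ 2 ν →L[ℂ] Lp ℂ 2 ν :=
  (ContinuousLinearMap.mul ℂ ℂ).holderL ν ∞ 2 2 (hg.toLp g)

theorem mulFn_coe (g : X → ℂ) (hg : MemLp g ∞ ν) (ξ : Lp ℂ 2 ν) :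
    mulFn g hg ξ =ᵐ[ν] fun x => g x * ξ x := by
  have h : mulFn g hg ξ =ᵐ[ν] fun x => hg.toLp g x * ξ x :=
    ContinuousLinearMap.coeFn_holder (r := 2) (ContinuousLinearMap.mul ℂ ℂ) (hg.toLp g) ξ
  filter_upwards [h, hg.coeFn_toLp] with x h1 h2
  rw [h1, h2]

theorem mulFn_congr {g g' : X → ℂ} (hg : MemLp g ∞ ν) (hg' : MemLp g' ∞ ν) (h : g =ᵐ[ν] g') :
    mulFn g hg = mulFn g' hg' := by
  rw [mulFn, mulFn, (MemLp.toLp_eq_toLp_iff hg hg').mpr h]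

theorem mulFn_eq_of_ae {g : X → ℂ} (hg : MemLp g ∞ ν) {ξ η : Lp ℂ 2 ν}
    (h : ∀ᵐ x ∂ν, η x = g x * ξ x) : mulFn g hg ξ = η := by
  refine Lp.ext ?_
  filter_upwards [mulFn_coe g hg ξ, h] with x h1 h2
  rw [h1, h2]

theorem mulFn_mul {f g k : X → ℂ} (hf : MemLp f ∞ ν) (hg : MemLp g ∞ ν) (hk : MemLp k ∞ ν)
    (h : ∀ᵐ x ∂ν, k x = f x * g x) : mulFn k hk = mulFn f hf * mulFn g hg := by
  ext1 ξ
  refine mulFn_eq_of_ae hk ?_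
  filter_upwards [h, mulFn_coe f hf (mulFn g hg ξ), mulFn_coe g hg ξ] with x h1 h2 h3
  rw [mul_apply_eq_comp, h2, h3, h1, mul_assoc]

theorem mulFn_add {f g k : X → ℂ} (hf : MemLp f ∞ ν) (hg : MemLp g ∞ ν) (hk : MemLp k ∞ ν)
    (h : ∀ᵐ x ∂ν, k x = f x + g x) : mulFn k hk = mulFn f hf + mulFn g hg := by
  ext1 ξ
  refine mulFn_eq_of_ae hk ?_
  filter_upwards [h, mulFn_coe f hf ξ, mulFn_coe g hg ξ,
    Lp.coeFn_add (mulFn f hf ξ) (mulFn g hg ξ)] with x h1 h2 h3 h4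
  rw [add_apply, h4, Pi.add_apply, h2, h3, h1, add_mul]

theorem mulFn_smul {f k : X → ℂ} (c : ℂ) (hf : MemLp f ∞ ν) (hk : MemLp k ∞ ν)
    (h : ∀ᵐ x ∂ν, k x = c * f x) : mulFn k hk = c • mulFn f hf := by
  ext1 ξ
  refine mulFn_eq_of_ae hk ?_
  filter_upwards [h, mulFn_coe f hf ξ, Lp.coeFn_smul c (mulFn f hf ξ)] with x h1 h2 h4
  rw [smul_apply, h4, Pi.smul_apply, h2, h1, smul_eq_mul, mul_assoc]

theorem mulFn_one {f : X → ℂ} (hf : MemLp f ∞ ν) (h : ∀ᵐ x ∂ν, f x = 1) : mulFn f hf = 1 := by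
  ext1 ξ
  refine mulFn_eq_of_ae hf ?_
  filter_upwards [h] with x h1
  rw [one_apply_eq_self, h1, one_mul]

theorem mulFn_star {f g : X → ℂ} (hf : MemLp f ∞ ν) (hg : MemLp g ∞ ν)
    (h : ∀ᵐ x ∂ν, g x = conj (f x)) : mulFn g hg = star (mulFn f hf) := by
  rw [ContinuousLinearMap.star_eq_adjoint, ContinuousLinearMap.eq_adjoint_iff]
  intro ξ η
  rw [L2.inner_def, L2.inner_def]
  refine integral_congr_ae ?_
  filter_upwards [h, mulFn_coe g hg ξ, mulFn_coe f hf η] with x h1 h2 h3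
  rw [h2, h3, h1]
  simp only [RCLike.inner_apply, map_mul, Complex.conj_conj]
  ring

variable (σ : X ≃ᵐ X) (m : X → ℂ)

/-- The data of a weighted composition unitary `ξ ↦ m · ξ ∘ σ` on `L²(ν)`. -/
structure IsWeight (ν : Measure X) (σ : X ≃ᵐ X) (m : X → ℂ) : Prop where
  meas : Measurable m
  ne_zero : ∀ᵐ x ∂ν, m x ≠ 0
  map_eq : (ν.withDensity fun x => ‖m x‖ₑ ^ (2 : ℝ)).map σ = ν

namespace IsWeight

variable {σ m} (hw : IsWeight ν σ m)
include hw

theorem measurable_density : Measurable fun x => ‖m x‖ₑ ^ (2 : ℝ) := by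
  have := hw.meas; fun_prop

/-- As `m` vanishes almost nowhere, `ν ≪ |m|² ν`; pushing forward by `σ` turns the right side into
`ν`. This makes `ξ ∘ σ` meaningful for classes `ξ`. -/
theorem quasi : Measure.QuasiMeasurePreserving σ ν ν := by
  refine ⟨σ.measurable, ?_⟩
  have h : ν ≪ ν.withDensity fun x => ‖m x‖ₑ ^ (2 : ℝ) := by
    refine withDensity_absolutelyContinuous' hw.measurable_density.aemeasurable ?_
    filter_upwards [hw.ne_zero] with x hx
    simp [hx]
  have := h.map σ.measurable
  rwa [hw.map_eq] at this

/-- Here only `|m|² ν ≪ ν` is needed: pulled back by `σ`, the measure `ν` becomes `|m|² ν`. -/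
theorem quasi_symm : Measure.QuasiMeasurePreserving σ.symm ν ν := by
  refine ⟨σ.symm.measurable, ?_⟩
  have h := (withDensity_absolutelyContinuous ν fun x => ‖m x‖ₑ ^ (2 : ℝ)).map σ.measurable
  rw [hw.map_eq] at h
  have := h.map σ.symm.measurable
  rwa [Measure.map_map σ.symm.measurable σ.measurable, σ.symm_comp_self, Measure.map_id] at this

theorem lintegral_eq (F : X → ℝ≥0∞) (hF : AEMeasurable F ν) :
    ∫⁻ x, ‖m x‖ₑ ^ (2 : ℝ) * F (σ x) ∂ν = ∫⁻ x, F x ∂ν := by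
  conv_rhs => rw [← hw.map_eq, lintegral_map_equiv]
  rw [lintegral_withDensity_eq_lintegral_mul₀ hw.measurable_density.aemeasurable]
  · rfl
  · exact hF.comp_quasiMeasurePreserving hw.quasi

theorem eLpNorm_eq (ξ : X → ℂ) (hξ : AEStronglyMeasurable ξ ν) :
    eLpNorm (fun x => m x * ξ (σ x)) 2 ν = eLpNorm ξ 2 ν := by
  rw [eLpNorm_eq_lintegral_rpow_enorm_toReal two_ne_zero ENNReal.ofNat_ne_top,
    eLpNorm_eq_lintegral_rpow_enorm_toReal two_ne_zero ENNReal.ofNat_ne_top]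
  congr 1
  simp only [ENNReal.toReal_ofNat, enorm_mul]
  rw [← hw.lintegral_eq (fun x => ‖ξ x‖ₑ ^ (2 : ℝ)) (hξ.enorm.pow_const _)]
  refine lintegral_congr fun x => ?_
  rw [ENNReal.mul_rpow_of_nonneg _ _ (by norm_num)]

theorem memLp (ξ : X → ℂ) (hξ : MemLp ξ 2 ν) : MemLp (fun x => m x * ξ (σ x)) 2 ν :=
  ⟨hw.meas.aestronglyMeasurable.mul (hξ.1.comp_quasiMeasurePreserving hw.quasi), by
    rw [hw.eLpNorm_eq ξ hξ.1]; exact hξ.2⟩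

theorem memLp_symm (η : X → ℂ) (hη : MemLp η 2 ν) :
    MemLp (fun x => η (σ.symm x) / m (σ.symm x)) 2 ν := by
  have h1 : AEStronglyMeasurable (fun x => η (σ.symm x) / m (σ.symm x)) ν :=
    (hη.1.comp_quasiMeasurePreserving hw.quasi_symm).div₀
      (hw.meas.comp σ.symm.measurable).aestronglyMeasurable
  refine ⟨h1, ?_⟩
  -- The norm of the candidate preimage is computed by applying the weighted composition to it,
  -- which returns `η` almost everywhere.
  rw [← hw.eLpNorm_eq _ h1]
  refine lt_of_eq_of_lt (eLpNorm_congr_ae ?_) hη.2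
  filter_upwards [hw.ne_zero] with x hx
  simp [mul_div_cancel₀ _ hx]

/-- The weighted composition operator as a linear isometry. -/
def isometry : Lp ℂ 2 ν →ₗᵢ[ℂ] Lp ℂ 2 ν where
  toFun ξ := (hw.memLp ξ (Lp.memLp ξ)).toLp
  map_add' ξ η := by
    refine Lp.ext ?_
    filter_upwards [(hw.memLp _ (Lp.memLp (ξ + η))).coeFn_toLp,
      (hw.memLp _ (Lp.memLp ξ)).coeFn_toLp, (hw.memLp _ (Lp.memLp η)).coeFn_toLp,
      Lp.coeFn_add (hw.memLp _ (Lp.memLp ξ)).toLp (hw.memLp _ (Lp.memLp η)).toLp,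
      hw.quasi.ae (Lp.coeFn_add ξ η)] with x h1 h2 h3 h4 h5
    rw [h1, h4, Pi.add_apply, h2, h3, h5, Pi.add_apply, mul_add]
  map_smul' c ξ := by
    refine Lp.ext ?_
    filter_upwards [(hw.memLp _ (Lp.memLp (c • ξ))).coeFn_toLp,
      (hw.memLp _ (Lp.memLp ξ)).coeFn_toLp,
      Lp.coeFn_smul c (hw.memLp _ (Lp.memLp ξ)).toLp,
      hw.quasi.ae (Lp.coeFn_smul c ξ)] with x h1 h2 h4 h5
    rw [h1, RingHom.id_apply, h4, Pi.smul_apply, h2, h5, Pi.smul_apply, smul_eq_mul, smul_eq_mul,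
      mul_left_comm]
  norm_map' ξ := by
    rw [Lp.norm_def, Lp.norm_def]
    congr 1
    change eLpNorm ((hw.memLp ξ (Lp.memLp ξ)).toLp : X → ℂ) 2 ν = _
    rw [eLpNorm_congr_ae (MemLp.coeFn_toLp (hw.memLp ξ (Lp.memLp ξ))), hw.eLpNorm_eq _ (Lp.aestronglyMeasurable ξ)]

theorem isometry_coe (ξ : Lp ℂ 2 ν) : hw.isometry ξ =ᵐ[ν] fun x => m x * ξ (σ x) :=
  MemLp.coeFn_toLp (hw.memLp ξ (Lp.memLp ξ))

theorem isometry_surjective : Function.Surjective hw.isometry := by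
  intro η
  refine ⟨(hw.memLp_symm η (Lp.memLp η)).toLp, Lp.ext ?_⟩
  filter_upwards [hw.isometry_coe (hw.memLp_symm η (Lp.memLp η)).toLp,
    hw.quasi.ae (hw.memLp_symm η (Lp.memLp η)).coeFn_toLp, hw.ne_zero] with x h1 h2 h3
  rw [h1, h2, σ.symm_apply_apply, mul_div_cancel₀ _ h3]

/-- The weighted composition operator `ξ ↦ m · ξ ∘ σ`. -/
def op : Lp ℂ 2 ν →L[ℂ] Lp ℂ 2 ν := hw.isometry.toContinuousLinearMap

theorem op_coe (ξ : Lp ℂ 2 ν) : hw.op ξ =ᵐ[ν] fun x => m x * ξ (σ x) := hw.isometry_coe ξ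

theorem op_mem_unitary : hw.op ∈ unitary (Lp ℂ 2 ν →L[ℂ] Lp ℂ 2 ν) := by
  have h1 : star hw.op * hw.op = 1 := by
    rw [ContinuousLinearMap.star_eq_adjoint]
    exact (ContinuousLinearMap.norm_map_iff_adjoint_comp_self hw.op).mp hw.isometry.norm_map
  refine Unitary.mem_iff.mpr ⟨h1, ?_⟩
  ext1 η
  obtain ⟨ξ, rfl⟩ := hw.isometry_surjective η
  change hw.op ((star hw.op * hw.op) ξ) = hw.op ξ
  rw [h1]
  rfl

theorem op_mul_mulFn {f g : X → ℂ} (hf : MemLp f ∞ ν) (hg : MemLp g ∞ ν)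
    (h : ∀ᵐ x ∂ν, g x = f (σ x)) : hw.op * mulFn f hf = mulFn g hg * hw.op := by
  ext1 ξ
  refine (mulFn_eq_of_ae hg ?_).symm
  filter_upwards [h, hw.op_coe (mulFn f hf ξ), hw.op_coe ξ,
    hw.quasi.ae (mulFn_coe f hf ξ)] with x h1 h2 h3 h4
  change (hw.op (mulFn f hf ξ)) x = g x * (hw.op ξ) x
  rw [h2, h3, h4, h1]
  ring

end IsWeight

end Operators

/-! ### Products with bounded functions -/

theorem memLp_top_mul {X : Type*} [MeasurableSpace X] {μ : Measure X} {f g : X → ℂ}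
    (hf : MemLp f ∞ μ) (hg : MemLp g ∞ μ) : MemLp (fun x => f x * g x) ∞ μ :=
  hg.mul (r := ∞) hf

theorem integrable_memLp_top_mul {X : Type*} [MeasurableSpace X] {μ : Measure X} {f g : X → ℂ}
    (hf : MemLp f ∞ μ) (hg : Integrable g μ) : Integrable (fun x => f x * g x) μ :=
  memLp_one_iff_integrable.mp ((memLp_one_iff_integrable.mpr hg).mul (r := 1) hf)

theorem memLp_top_normSq {X : Type*} [MeasurableSpace X] {μ : Measure X} {f : X → ℂ}
    (hf : MemLp f ∞ μ) : MemLp (fun x => ((‖f x‖ ^ 2 : ℝ) : ℂ)) ∞ μ := by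
  refine (memLp_top_mul hf.star hf).ae_eq (Eventually.of_forall fun x => ?_)
  simp only [Pi.star_apply, RCLike.star_def]
  rw [mul_comm, Complex.mul_conj, Complex.normSq_eq_norm_sq]

theorem memLp_top_of_continuous {X : Type*} [TopologicalSpace X] [CompactSpace X]
    [MeasurableSpace X] [OpensMeasurableSpace X] (μ : Measure X) (f : C(X, ℂ)) :
    MemLp f ∞ μ := by
  refine memLp_top_of_bound f.continuous.aestronglyMeasurable ‖f‖
    (Eventually.of_forall f.norm_coe_le_norm)

/-! ### Haar measure on the circle and the power map -/

local instance : (haarT).IsHaarMeasure := by unfold haarT; infer_instance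

/-- A measurable `N`-th root on the circle. -/
def root (N : ℕ) (z : Circle) : Circle := Circle.exp (Complex.arg z / N)

theorem continuous_coe_circle : Continuous fun z : Circle => (z : ℂ) := continuous_induced_dom

theorem measurable_arg_circle : Measurable fun z : Circle => Complex.arg z :=
  Complex.measurable_arg.comp continuous_coe_circle.measurable

theorem circle_exp_pow (n : ℕ) (x : ℝ) : Circle.exp x ^ n = Circle.exp (n * x) := by
  induction n with
  | zero => simp
  | succ n ih => rw [pow_succ, ih, ← Circle.exp_add]; congr 1; push_cast; ring

theorem root_pow (N : ℕ) [NeZero N] (z : Circle) : root N z ^ N = z := by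
  have hN : (N : ℝ) ≠ 0 := Nat.cast_ne_zero.mpr (NeZero.ne N)
  rw [root, circle_exp_pow, mul_div_cancel₀ _ hN, Circle.exp_arg]

theorem measurable_root (N : ℕ) : Measurable (root N) :=
  Circle.exp.continuous.measurable.comp (measurable_arg_circle.div_const _)

theorem circle_pow_surjective (N : ℕ) [NeZero N] :
    Function.Surjective fun z : Circle => z ^ N := fun z => by
  exact ⟨root N z, root_pow N z⟩

theorem measurePreserving_pow (N : ℕ) [NeZero N] :
    MeasurePreserving (fun z : Circle => z ^ N) haarT haarT :=
  (powMonoidHom N : Circle →* Circle).measurePreserving (continuous_pow N)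
    (circle_pow_surjective N) rfl

/-- Since `z ↦ z ^ N` preserves Haar measure, the preimage of `A` may be measured after pulling it
back to the points `w` with `root N (w ^ N) ∈ A`. As `root N (w ^ N)` is `w` times an `N`-th root of
unity, these points lie in finitely many translates of `A`. The lemma serves to descend
measurability from `f(z ^ N)` to `f`. -/
theorem quasiMeasurePreserving_root (N : ℕ) [NeZero N] :
    Measure.QuasiMeasurePreserving (root N) haarT haarT := by
  refine ⟨measurable_root N, Measure.AbsolutelyContinuous.mk fun A hA h0 => ?_⟩
  rw [Measure.map_apply (measurable_root N) hA,
    ← (measurePreserving_pow N).measure_preimage (measurable_root N hA).nullMeasurableSet]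
  refine measure_mono_null (t := ⋃ ζ : rootsOfUnity N Circle, {w | w * (ζ : Circleˣ) ∈ A}) ?_ ?_
  · intro w hw
    have h : (root N (w ^ N) / w) ^ N = 1 := by rw [div_pow, root_pow, div_self']
    refine Set.mem_iUnion.mpr ⟨⟨toUnits (root N (w ^ N) / w), ?_⟩, ?_⟩
    · rw [mem_rootsOfUnity, ← map_pow, h, map_one]
    · simpa using hw
  · refine measure_iUnion_null fun ζ => ?_
    have := (measurePreserving_mul_right haarT ((ζ : Circleˣ) : Circle)).measure_preimage
      hA.nullMeasurableSet
    exact this.trans h0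

/-! ### The transfer operator -/

local instance (N : ℕ) [NeZero N] : Fintype (rootsOfUnity N Circle) :=
  Fintype.ofFinite _

theorem card_rootsOfUnity_circle (N : ℕ) [NeZero N] :
    Fintype.card (rootsOfUnity N Circle) = N := by
  rw [← Nat.card_eq_fintype_card, Nat.card_congr (rootsOfUnityCircleEquiv N).toEquiv,
    Complex.card_rootsOfUnity]

/-- The fibre through `w` is the coset of `w` by the `N`-th roots of unity. Evaluating at `w ^ N`
avoids any choice of branch. -/
theorem ruelle_pow (N : ℕ) [NeZero N] (m₀ f : Circle → ℂ) (w : Circle) :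
    ruelle N m₀ f (w ^ N) = (N : ℂ)⁻¹ * ∑ ζ : rootsOfUnity N Circle,
      ((‖m₀ (w * (ζ : Circleˣ))‖ ^ 2 : ℝ) : ℂ) * f (w * (ζ : Circleˣ)) := by
  rw [ruelle]
  congr 1
  have hinj : Function.Injective fun ζ : rootsOfUnity N Circle => w * ((ζ : Circleˣ) : Circle) := by
    intro a b hab
    exact Subtype.ext (Units.ext (mul_left_cancel hab))
  have hset : ∀ v : Circle, v ^ N = w ^ N ↔
      v ∈ Set.range fun ζ : rootsOfUnity N Circle => w * ((ζ : Circleˣ) : Circle) := by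
    intro v
    constructor
    · intro hv
      have h : (v / w) ^ N = 1 := by rw [div_pow, hv, div_self']
      refine ⟨⟨toUnits (v / w), ?_⟩, ?_⟩
      · rw [mem_rootsOfUnity, ← map_pow, h, map_one]
      · simp
    · rintro ⟨ζ, rfl⟩
      have h : ((ζ : Circleˣ) : Circle) ^ N = 1 := by
        have := (mem_rootsOfUnity N (ζ : Circleˣ)).mp ζ.2
        exact_mod_cast congrArg Units.val this
      simp [mul_pow, h]
  simp_rw [hset]
  rw [finsum_mem_range (f := fun v => ((‖m₀ v‖ ^ 2 : ℝ) : ℂ) * f v) hinj,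
    finsum_eq_sum_of_fintype]

section Transfer

variable (N : ℕ) [NeZero N] {m₀ : Circle → ℂ} (hm : MemLp m₀ ∞ haarT)
include hm

theorem integrable_ruelle {f : Circle → ℂ} (hf : Integrable f haarT) :
    Integrable (ruelle N m₀ f) haarT := by
  have h1 : Integrable (fun w => ruelle N m₀ f (w ^ N)) haarT := by
    simp only [ruelle_pow]
    refine (integrable_finsetSum _ fun ζ _ => ?_).const_mul _
    exact ((measurePreserving_mul_right haarT ((ζ : Circleˣ) : Circle)).integrable_comp
      (integrable_memLp_top_mul (memLp_top_normSq hm) hf).1).mpr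
      (integrable_memLp_top_mul (memLp_top_normSq hm) hf)
  -- Composing `ruelle N m₀ f (w ^ N)`, a finite sum of translates, with the measurable root
  -- recovers `ruelle N m₀ f`.
  have h2 : AEStronglyMeasurable (ruelle N m₀ f) haarT := by
    refine (h1.1.comp_quasiMeasurePreserving (quasiMeasurePreserving_root N)).congr ?_
    exact Eventually.of_forall fun z => by simp [root_pow]
  exact ((measurePreserving_pow N).integrable_comp h2).mp h1

/-- The duality between the transfer operator and composition with the power map. -/
theorem integral_mul_ruelle {f g : Circle → ℂ} (hf : Integrable f haarT) (hg : MemLp g ∞ haarT) :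
    ∫ z, g z * ruelle N m₀ f z ∂haarT =
      ∫ z, g (z ^ N) * (((‖m₀ z‖ ^ 2 : ℝ) : ℂ) * f z) ∂haarT := by
  have hG : Integrable (fun z => g (z ^ N) * (((‖m₀ z‖ ^ 2 : ℝ) : ℂ) * f z)) haarT :=
    integrable_memLp_top_mul (hg.comp_measurePreserving (measurePreserving_pow N))
      (integrable_memLp_top_mul (memLp_top_normSq hm) hf)
  have hI := integrable_memLp_top_mul hg (integrable_ruelle N hm hf)
  have h1 : ∫ z, g z * ruelle N m₀ f z ∂haarT =
      ∫ w, g (w ^ N) * ruelle N m₀ f (w ^ N) ∂haarT := by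
    conv_lhs => rw [← (measurePreserving_pow N).map_eq]
    rw [integral_map (measurePreserving_pow N).aemeasurable]
    rw [(measurePreserving_pow N).map_eq]
    exact hI.1
  have hpow : ∀ ζ : rootsOfUnity N Circle, ((ζ : Circleˣ) : Circle) ^ N = 1 := fun ζ => by
    exact_mod_cast congrArg Units.val ((mem_rootsOfUnity N (ζ : Circleˣ)).mp ζ.2)
  have h2 : ∀ w : Circle, g (w ^ N) * ruelle N m₀ f (w ^ N) = (N : ℂ)⁻¹ *
      ∑ ζ : rootsOfUnity N Circle, g ((w * (ζ : Circleˣ)) ^ N) *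
        (((‖m₀ (w * (ζ : Circleˣ))‖ ^ 2 : ℝ) : ℂ) * f (w * (ζ : Circleˣ))) := by
    intro w
    rw [ruelle_pow, mul_left_comm, Finset.mul_sum]
    simp only [mul_pow, hpow, mul_one]
  rw [h1]
  simp_rw [h2]
  rw [integral_const_mul, integral_finsetSum]
  -- By translation invariance the `N` summands have the same integral, which cancels the factor
  -- `N⁻¹`.
  · simp_rw [fun ζ : rootsOfUnity N Circle => integral_mul_right_eq_self (μ := haarT)
      (fun z => g (z ^ N) * (((‖m₀ z‖ ^ 2 : ℝ) : ℂ) * f z)) ((ζ : Circleˣ) : Circle)]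
    rw [Finset.sum_const, Finset.card_univ, card_rootsOfUnity_circle, nsmul_eq_mul,
      inv_mul_cancel_left₀ (Nat.cast_ne_zero.mpr (NeZero.ne N))]
  · intro ζ _
    exact ((measurePreserving_mul_right haarT ((ζ : Circleˣ) : Circle)).integrable_comp hG.1).mpr hG

end Transfer

/-- The cocycle `m₀(z) m₀(z ^ N) ⋯ m₀(z ^ (N ^ (i - 1)))`. -/
def cocycle (N : ℕ) (m₀ : Circle → ℂ) (i : ℕ) (z : Circle) : ℂ :=
  ∏ j ∈ Finset.range i, m₀ (z ^ N ^ j)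

@[simp] theorem cocycle_zero (N : ℕ) (m₀ : Circle → ℂ) (z : Circle) : cocycle N m₀ 0 z = 1 := rfl

theorem cocycle_succ (N : ℕ) (m₀ : Circle → ℂ) (i : ℕ) (z : Circle) :
    cocycle N m₀ (i + 1) z = cocycle N m₀ i z * m₀ (z ^ N ^ i) := Finset.prod_range_succ _ _

/-- Splitting off the factor at `z` fits the duality for the transfer operator; `cocycle_succ`,
which splits off the factor at `z ^ N ^ i`, fits the weight on `K N`. -/
theorem cocycle_succ' (N : ℕ) (m₀ : Circle → ℂ) (i : ℕ) (z : Circle) :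
    cocycle N m₀ (i + 1) z = cocycle N m₀ i (z ^ N) * m₀ z := by
  rw [cocycle, Finset.prod_range_succ', cocycle]
  simp only [pow_zero, pow_one, ← pow_mul, ← pow_succ']

theorem memLp_cocycle (N : ℕ) [NeZero N] {m₀ : Circle → ℂ} (hm : MemLp m₀ ∞ haarT) (i : ℕ) :
    MemLp (cocycle N m₀ i) ∞ haarT := by
  induction i with
  | zero => exact memLp_const 1
  | succ i ih =>
    have := memLp_top_mul ih (hm.comp_measurePreserving (measurePreserving_pow (N ^ i)))
    exact this.ae_eq (Eventually.of_forall fun z => (cocycle_succ N m₀ i z).symm)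

/-- Each application of the duality, with `|m₀⁽ⁱ⁾|²` as test function, composes it with the power
map and multiplies it by `|m₀|²`, which produces the next cocycle. -/
theorem integral_iterate_ruelle (N : ℕ) [NeZero N] {m₀ : Circle → ℂ} (hm : MemLp m₀ ∞ haarT)
    (i : ℕ) {f : Circle → ℂ} (hf : Integrable f haarT) :
    ∫ z, (ruelle N m₀)^[i] f z ∂haarT =
      ∫ z, ((‖cocycle N m₀ i z‖ ^ 2 : ℝ) : ℂ) * f z ∂haarT := by
  induction i generalizing f with
  | zero => simp
  | succ i ih =>
    rw [Function.iterate_succ_apply, ih (integrable_ruelle N hm hf),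
      integral_mul_ruelle N hm hf (memLp_top_normSq (memLp_cocycle N hm i))]
    refine integral_congr_ae (Eventually.of_forall fun z => ?_)
    simp only [cocycle_succ', norm_mul, mul_pow, Complex.ofReal_mul]
    ring

/-! ### The measures `|m₀⁽ⁱ⁾|² h dμ` -/

/-- The measure `|m₀(z) ⋯ m₀(z ^ (N ^ (i - 1)))|² h dμ` on the circle. -/
def level (N : ℕ) (m₀ : Circle → ℂ) (h : Circle → ℝ) (i : ℕ) : Measure Circle :=
  haarT.withDensity fun z => ENNReal.ofReal (‖cocycle N m₀ i z‖ ^ 2 * h z)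

theorem level_absolutelyContinuous (N : ℕ) (m₀ : Circle → ℂ) (h : Circle → ℝ) (i : ℕ) :
    level N m₀ h i ≪ haarT := withDensity_absolutelyContinuous _ _

section Level

variable (N : ℕ) [NeZero N] {m₀ : Circle → ℂ} (hm : MemLp m₀ ∞ haarT) {h : Circle → ℝ}
  (hh : Integrable h haarT)
include hm hh

theorem integrable_cocycle_mul (i : ℕ) :
    Integrable (fun z => ‖cocycle N m₀ i z‖ ^ 2 * h z) haarT := by
  have := integrable_memLp_top_mul (memLp_top_normSq (memLp_cocycle N hm i)) hh.ofReal
  refine this.re.congr (Eventually.of_forall fun z => ?_)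
  change (((‖cocycle N m₀ i z‖ ^ 2 : ℝ) : ℂ) * (h z : ℂ)).re = _
  rw [← Complex.ofReal_mul, Complex.ofReal_re]

theorem isFiniteMeasure_level (i : ℕ) : IsFiniteMeasure (level N m₀ h i) :=
  isFiniteMeasure_withDensity_ofReal (integrable_cocycle_mul N hm hh i).2

theorem integral_level (h0 : ∀ᵐ z ∂haarT, 0 ≤ h z) (i : ℕ) (f : Circle → ℂ) :
    ∫ z, f z ∂(level N m₀ h i) =
      ∫ z, ((‖cocycle N m₀ i z‖ ^ 2 : ℝ) : ℂ) * (f z * (h z : ℂ)) ∂haarT := by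
  rw [level, integral_withDensity_eq_integral_toReal_smul₀
    (integrable_cocycle_mul N hm hh i).1.aemeasurable.ennreal_ofReal
    (Eventually.of_forall fun _ => ENNReal.ofReal_lt_top)]
  refine integral_congr_ae ?_
  filter_upwards [h0] with z hz
  rw [ENNReal.toReal_ofReal (by positivity), Complex.real_smul, Complex.ofReal_mul]
  ring

theorem integral_iterate_ruelle_eq_level (h0 : ∀ᵐ z ∂haarT, 0 ≤ h z) (i : ℕ) (f : C(Circle, ℂ)) :
    ∫ z, (ruelle N m₀)^[i] (fun w => f w * (h w : ℂ)) z ∂haarT =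
      ∫ z, f z ∂(level N m₀ h i) := by
  rw [integral_level N hm hh h0, integral_iterate_ruelle N hm]
  exact integrable_memLp_top_mul (memLp_top_of_continuous _ f) hh.ofReal

/-- This compatibility of successive levels is where the eigenfunction equation enters: the duality
is applied to `h` itself, and `R h` is then replaced by `h`. -/
theorem integral_pow_level_succ (h0 : ∀ᵐ z ∂haarT, 0 ≤ h z)
    (hR : ∀ᵐ z ∂haarT, ruelle N m₀ (fun w => (h w : ℂ)) z = (h z : ℂ)) (i : ℕ)
    {f : Circle → ℂ} (hf : MemLp f ∞ haarT) :
    ∫ z, f (z ^ N) ∂(level N m₀ h (i + 1)) = ∫ z, f z ∂(level N m₀ h i) := by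
  rw [integral_level N hm hh h0, integral_level N hm hh h0]
  have := integral_mul_ruelle N hm hh.ofReal
    (memLp_top_mul (memLp_top_normSq (memLp_cocycle N hm i)) hf)
  have h2 : ∫ z, ((‖cocycle N m₀ i z‖ ^ 2 : ℝ) : ℂ) * f z *
      ruelle N m₀ (fun w => (h w : ℂ)) z ∂haarT =
      ∫ z, ((‖cocycle N m₀ i z‖ ^ 2 : ℝ) : ℂ) * (f z * (h z : ℂ)) ∂haarT := by
    refine integral_congr_ae ?_
    filter_upwards [hR] with z hz
    rw [hz, mul_assoc]
  rw [← h2]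
  refine Eq.trans ?_ this.symm
  refine integral_congr_ae (Eventually.of_forall fun z => ?_)
  simp only [cocycle_succ', norm_mul, mul_pow, Complex.ofReal_mul]
  change _ = _ * (_ * (h z : ℂ))
  ring

theorem integral_pow_level (h0 : ∀ᵐ z ∂haarT, 0 ≤ h z)
    (hR : ∀ᵐ z ∂haarT, ruelle N m₀ (fun w => (h w : ℂ)) z = (h z : ℂ)) (i d : ℕ)
    {f : Circle → ℂ} (hf : MemLp f ∞ haarT) :
    ∫ z, f (z ^ N ^ d) ∂(level N m₀ h (i + d)) = ∫ z, f z ∂(level N m₀ h i) := by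
  induction d generalizing f with
  | zero => simp
  | succ d ih =>
    rw [← ih hf, ← add_assoc, ← integral_pow_level_succ N hm hh h0 hR (i + d)
      (f := fun z => f (z ^ N ^ d)) (hf.comp_measurePreserving (measurePreserving_pow (N ^ d)))]
    simp only [← pow_mul, ← pow_succ']

end Level

/-! ### The exponentials `e_n` -/

@[simp] theorem e_apply (n : ℤ) (z : Circle) : e n z = ((z ^ n : Circle) : ℂ) := rfl

theorem e_zero : e 0 = 1 := by ext z; simp

theorem e_mul (m n : ℤ) : e m * e n = e (m + n) := by
  ext z; simp [zpow_add]

theorem star_e (n : ℤ) : star (e n) = e (-n) := by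
  ext z
  simp only [ContinuousMap.star_apply, e_apply, zpow_neg, Circle.coe_inv_eq_conj]
  rfl

theorem e_comp_powMap (N : ℕ) (n : ℤ) : (e n).comp (powMap N) = e (n * N) := by
  ext z
  simp only [ContinuousMap.comp_apply, e_apply, powMap, ContinuousMap.coe_mk]
  rw [← zpow_natCast, ← zpow_mul, mul_comm]

theorem span_e : (Submodule.span ℂ (Set.range e)).topologicalClosure = ⊤ := by
  refine span_topologicalClosure_eq_top e ⟨0, e_zero⟩ (fun i j => ⟨_, e_mul i j⟩)
    (fun i => ⟨_, star_e i⟩) fun x y hxy => ⟨1, fun h => hxy ?_⟩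
  simpa [Circle.ext_iff] using h

/-! ### The algebras `𝔄_N` and `𝒜_N` -/

variable (N : ℕ)

/-- Minimality of the closure is available inside the ambient product, so `S` is first moved there;
its image stays closed because `𝔄 N` is closed in the product. -/
theorem eq_top_of_generators_mem (S : StarSubalgebra ℂ (𝔄 N)) (hS : IsClosed (S : Set (𝔄 N)))
    (hι : ∀ f, ι N f ∈ S) (hU : U N ∈ S) (a : 𝔄 N) : a ∈ S := by
  let T : StarSubalgebra ℂ (Fam N) := S.map (univSubalgebra N).subtype
  have hT : IsClosed (T : Set (Fam N)) := by
    have h := (StarSubalgebra.isClosed_topologicalClosure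
      (StarAlgebra.adjoin ℂ (famGen N))).isClosedEmbedding_subtypeVal.isClosedMap
    exact h _ hS
  have h : univSubalgebra N ≤ T := by
    refine StarSubalgebra.topologicalClosure_minimal (StarAlgebra.adjoin_le ?_) hT
    rintro _ (⟨f, rfl⟩ | rfl)
    · exact ⟨ι N f, hι f, rfl⟩
    · exact ⟨U N, hU, rfl⟩
  obtain ⟨b, hb, hba⟩ := h a.2
  have : b = a := Subtype.ext hba
  exact this ▸ hb

theorem star_U_mul_U : star (U N) * U N = 1 := (Unitary.mem_iff.mp (U_mem_unitary N)).1

theorem U_pow_mul_star_U_pow (i : ℕ) : U N ^ i * star (U N) ^ i = 1 := by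
  rw [← star_pow]
  exact (Unitary.mem_iff.mp (pow_mem (U_mem_unitary N) i)).2

theorem star_U_pow_mul_U_pow (i : ℕ) : star (U N) ^ i * U N ^ i = 1 := by
  rw [← star_pow]
  exact (Unitary.mem_iff.mp (pow_mem (U_mem_unitary N) i)).1

/-- The homomorphism `f ↦ U⁻ⁱ f Uⁱ`. -/
def conjHom (i : ℕ) : C(Circle, ℂ) →⋆ₐ[ℂ] 𝔄 N where
  toFun := conjGen N i
  map_one' := by simp [conjGen, star_U_pow_mul_U_pow]
  map_mul' f g := by
    simp only [conjGen, map_mul]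
    calc _ = star (U N) ^ i * ι N f * 1 * ι N g * U N ^ i := by simp only [mul_assoc, one_mul]
      _ = _ := by rw [← U_pow_mul_star_U_pow N i]; simp only [mul_assoc]
  map_zero' := by simp [conjGen]
  map_add' f g := by simp [conjGen, mul_add, add_mul]
  commutes' c := by
    rw [conjGen, AlgHomClass.commutes, ← Algebra.commutes, mul_assoc, star_U_pow_mul_U_pow, mul_one]
  map_star' f := by
    simp [conjGen, map_star, mul_assoc]

theorem conjHom_apply (i : ℕ) (f : C(Circle, ℂ)) : conjHom N i f = conjGen N i f := rfl

/-- The covariance relation, conjugated by powers of `U`: the copy of `C(𝕋)` at level `i` lies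
inside the copy at level `i + 1`. -/
theorem conjGen_succ_comp (i : ℕ) (f : C(Circle, ℂ)) :
    conjGen N (i + 1) (f.comp (powMap N)) = conjGen N i f := by
  rw [conjGen, ← U_cov, pow_succ, pow_succ', conjGen]
  calc _ = star (U N) ^ i * (star (U N) * U N) * ι N f * (star (U N) * U N) * U N ^ i := by
        simp only [mul_assoc]
    _ = _ := by rw [star_U_mul_U, mul_one, mul_one]

theorem exists_conjGen_eq (i d : ℕ) (f : C(Circle, ℂ)) :
    ∃ g, conjGen N i f = conjGen N (i + d) g := by
  induction d with
  | zero => exact ⟨f, rfl⟩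
  | succ d ih =>
    obtain ⟨g, hg⟩ := ih
    exact ⟨g.comp (powMap N), by rw [← add_assoc, conjGen_succ_comp, hg]⟩

theorem conjGen_comm (i j : ℕ) (f g : C(Circle, ℂ)) :
    conjGen N i f * conjGen N j g = conjGen N j g * conjGen N i f := by
  obtain ⟨f', hf⟩ := exists_conjGen_eq N i j f
  obtain ⟨g', hg⟩ := exists_conjGen_eq N j i g
  rw [hf, hg, add_comm j i, ← conjHom_apply, ← conjHom_apply, ← map_mul, mul_comm, map_mul]

theorem isClosed_𝒜 : IsClosed (𝒜 N : Set (𝔄 N)) := StarSubalgebra.isClosed_topologicalClosure _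

local instance : IsClosed (𝒜 N : Set (𝔄 N)) := isClosed_𝒜 N

/-- The elements of a closed star subalgebra of `𝔄_N` containing all `U⁻ⁱ f Uⁱ`. -/
theorem 𝒜_le (S : StarSubalgebra ℂ (𝔄 N)) (hS : IsClosed (S : Set (𝔄 N)))
    (h : ∀ i f, conjGen N i f ∈ S) : 𝒜 N ≤ S := by
  refine StarSubalgebra.topologicalClosure_minimal (StarAlgebra.adjoin_le ?_) hS
  rintro _ ⟨i, f, rfl⟩
  exact h i f

theorem 𝒜_mul_comm (a b : 𝒜 N) : a * b = b * a := by
  have hcl : ∀ x : 𝔄 N, IsClosed (StarSubalgebra.centralizer ℂ {x} : Set (𝔄 N)) := fun x => by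
    rw [StarSubalgebra.coe_centralizer]
    exact Set.isClosed_centralizer _
  have hstar : ∀ i f, star (conjGen N i f) = conjGen N i (star f) := fun i f => by
    rw [← conjHom_apply, ← map_star]; rfl
  -- Two passes through closed centralizers: first a generator commutes with all of `𝒜 N`, then so
  -- does an arbitrary element.
  have h1 : ∀ i f, 𝒜 N ≤ StarSubalgebra.centralizer ℂ {conjGen N i f} := fun i f => by
    refine 𝒜_le N _ (hcl _) fun j g => ?_
    rw [StarSubalgebra.mem_centralizer_iff]
    rintro _ rfl
    exact ⟨conjGen_comm N _ _ _ _, by rw [hstar]; exact conjGen_comm N _ _ _ _⟩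
  have h2 : 𝒜 N ≤ StarSubalgebra.centralizer ℂ {(a : 𝔄 N)} := by
    refine 𝒜_le N _ (hcl _) fun j g => ?_
    rw [StarSubalgebra.mem_centralizer_iff]
    rintro _ rfl
    exact ⟨((((StarSubalgebra.mem_centralizer_iff ℂ).mp (h1 j g a.2)) _ rfl).1).symm,
      ((((StarSubalgebra.mem_centralizer_iff ℂ).mp (h1 j g (star_mem a.2))) _ rfl).1).symm⟩
  exact Subtype.ext ((((StarSubalgebra.mem_centralizer_iff ℂ).mp (h2 b.2)) _ rfl).1)

local instance : CommCStarAlgebra (𝒜 N) :=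
  { (inferInstance : CStarAlgebra (𝒜 N)) with mul_comm := 𝒜_mul_comm N }

/-- The homomorphism `f ↦ U⁻ⁱ f Uⁱ` into `𝒜_N`. -/
def genHom (i : ℕ) : C(Circle, ℂ) →⋆ₐ[ℂ] 𝒜 N :=
  (conjHom N i).codRestrict (𝒜 N) fun f => (gen N i f).2

theorem genHom_apply (i : ℕ) (f : C(Circle, ℂ)) : genHom N i f = gen N i f := rfl

theorem gen_succ_comp (i : ℕ) (f : C(Circle, ℂ)) :
    gen N (i + 1) (f.comp (powMap N)) = gen N i f := Subtype.ext (conjGen_succ_comp N i f)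

theorem gen_add_e (i d : ℕ) (n : ℤ) : gen N (i + d) (e (n * N ^ d)) = gen N i (e n) := by
  induction d with
  | zero => simp
  | succ d ih =>
    rw [← ih, ← gen_succ_comp N (i + d), e_comp_powMap, pow_succ, mul_assoc, add_assoc]

/-! ### The group `Λ_N` -/

theorem frac_eq_iff [NeZero N] (n m : ℤ) (k l : ℕ) :
    frac N n k = frac N m l ↔ n * N ^ l = m * N ^ k := by
  have hN : (N : ℚ) ≠ 0 := Nat.cast_ne_zero.mpr (NeZero.ne N)
  have h : frac N n k = frac N m l ↔ (n : ℚ) / (N : ℚ) ^ k = (m : ℚ) / (N : ℚ) ^ l :=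
    Subtype.ext_iff
  rw [h, div_eq_div_iff (pow_ne_zero _ hN) (pow_ne_zero _ hN)]
  exact_mod_cast Iff.rfl

theorem frac_add (n m : ℤ) (k : ℕ) : frac N n k + frac N m k = frac N (n + m) k :=
  Subtype.ext (by
    change (n : ℚ) / (N : ℚ) ^ k + (m : ℚ) / (N : ℚ) ^ k = ((n + m : ℤ) : ℚ) / (N : ℚ) ^ k
    push_cast; ring)

theorem frac_mul (n m : ℤ) (k l : ℕ) : frac N n k * frac N m l = frac N (n * m) (k + l) :=
  Subtype.ext (by
    change (n : ℚ) / (N : ℚ) ^ k * ((m : ℚ) / (N : ℚ) ^ l) = ((n * m : ℤ) : ℚ) / (N : ℚ) ^ (k + l)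
    push_cast; rw [div_mul_div_comm, pow_add])

theorem frac_zero_right (n : ℤ) : frac N n 0 = (n : Lam N) :=
  Subtype.ext (by
    change (n : ℚ) / (N : ℚ) ^ 0 = _
    rw [pow_zero, div_one]
    rfl)

theorem neg_frac (n : ℤ) (k : ℕ) : -frac N n k = frac N (-n) k :=
  Subtype.ext (by
    change -((n : ℚ) / (N : ℚ) ^ k) = ((-n : ℤ) : ℚ) / (N : ℚ) ^ k
    push_cast; ring)

theorem frac_add_pow [NeZero N] (n : ℤ) (k d : ℕ) :
    frac N (n * N ^ d) (k + d) = frac N n k := by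
  rw [frac_eq_iff, pow_add]; ring

theorem exists_frac [NeZero N] (lam : Lam N) : ∃ n k, lam = frac N n k := by
  obtain ⟨x, hx⟩ := lam
  induction hx using Subring.closure_induction with
  | mem x hx =>
    obtain rfl := hx
    exact ⟨1, 1, Subtype.ext (by change (N : ℚ)⁻¹ = ((1 : ℤ) : ℚ) / (N : ℚ) ^ 1; simp)⟩
  | zero => exact ⟨0, 0, Subtype.ext (by change (0 : ℚ) = ((0 : ℤ) : ℚ) / (N : ℚ) ^ 0; simp)⟩
  | one => exact ⟨1, 0, Subtype.ext (by change (1 : ℚ) = ((1 : ℤ) : ℚ) / (N : ℚ) ^ 0; simp)⟩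
  | add x y hx hy h1 h2 =>
    obtain ⟨n, k, h1⟩ := h1
    obtain ⟨m, l, h2⟩ := h2
    refine ⟨n * N ^ l + m * N ^ k, k + l, ?_⟩
    rw [← frac_add, frac_add_pow, add_comm k l, frac_add_pow, ← h1, ← h2]
    rfl
  | neg x hx h1 =>
    obtain ⟨n, k, h1⟩ := h1
    exact ⟨-n, k, by rw [← neg_frac, ← h1]; rfl⟩
  | mul x y hx hy h1 h2 =>
    obtain ⟨n, k, h1⟩ := h1
    obtain ⟨m, l, h2⟩ := h2
    exact ⟨n * m, k + l, by rw [← frac_mul, ← h1, ← h2]; rfl⟩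

theorem exists_frac₂ [NeZero N] (a b : Lam N) : ∃ n m k, a = frac N n k ∧ b = frac N m k := by
  obtain ⟨n, k, rfl⟩ := exists_frac N a
  obtain ⟨m, l, rfl⟩ := exists_frac N b
  exact ⟨n * N ^ l, m * N ^ k, k + l, (frac_add_pow N n k l).symm, by
    rw [add_comm, frac_add_pow]⟩

/-- Independence of the chosen fraction: both sides are raised to level `k + l`, where the
numerators coincide. -/
theorem gen_e_eq_of_frac_eq [NeZero N] {n m : ℤ} {k l : ℕ} (h : frac N n k = frac N m l) :
    gen N k (e n) = gen N l (e m) := by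
  rw [← gen_add_e N k l, ← gen_add_e N l k, (frac_eq_iff N n m k l).mp h, add_comm]

/-- The homomorphism `n / N ^ k ↦ U⁻ᵏ e_n Uᵏ` from `Λ_N` to `𝒜_N`. -/
def expHom [NeZero N] : Multiplicative (Lam N) →* 𝒜 N where
  toFun lam := gen N (exists_frac N lam.toAdd).choose_spec.choose
    (e (exists_frac N lam.toAdd).choose)
  map_one' := by
    rw [gen_e_eq_of_frac_eq N (m := 0) (l := 0)
      ((exists_frac N _).choose_spec.choose_spec.symm.trans ?_), e_zero]
    · exact map_one (genHom N 0)
    · rw [frac_zero_right, Int.cast_zero]; rfl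
  map_mul' a b := by
    obtain ⟨n, m, k, ha, hb⟩ := exists_frac₂ N a.toAdd b.toAdd
    rw [gen_e_eq_of_frac_eq N ((exists_frac N a.toAdd).choose_spec.choose_spec.symm.trans ha),
      gen_e_eq_of_frac_eq N ((exists_frac N b.toAdd).choose_spec.choose_spec.symm.trans hb),
      gen_e_eq_of_frac_eq N (m := n + m) (l := k)
        ((exists_frac N (a * b).toAdd).choose_spec.choose_spec.symm.trans ?_), ← e_mul]
    · exact map_mul (genHom N k) _ _
    · rw [toAdd_mul, ha, hb, frac_add]

theorem expHom_frac [NeZero N] (n : ℤ) (k : ℕ) :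
    expHom N (Multiplicative.ofAdd (frac N n k)) = gen N k (e n) :=
  gen_e_eq_of_frac_eq N (exists_frac N (frac N n k)).choose_spec.choose_spec.symm

/-- Forces a character of `𝒜 N` to take values of modulus one on these elements. -/
theorem star_gen_e_mul (n : ℤ) (k : ℕ) : star (gen N k (e n)) * gen N k (e n) = 1 := by
  rw [← genHom_apply, ← map_star, ← map_mul, star_e, e_mul, neg_add_cancel, e_zero, map_one]

/-! ### The dual group `K_N` -/

local instance (N : ℕ) [NeZero N] : Countable (Lam N) :=
  Function.Surjective.countable (f := fun p : ℤ × ℕ => frac N p.1 p.2) fun lam => by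
    obtain ⟨n, k, h⟩ := exists_frac N lam
    exact ⟨(n, k), h.symm⟩

theorem isInducing_toContinuousMap_K (N : ℕ) : Topology.IsInducing
    (fun χ : K N => (ContinuousMonoidHom.toContinuousMap
      (show Multiplicative (Lam N) →ₜ* Circle from χ))) :=
  ContinuousMonoidHom.isInducing_toContinuousMap _ _

local instance (N : ℕ) [NeZero N] : SecondCountableTopology (K N) := by
  have : Countable (Multiplicative (Lam N)) := inferInstanceAs (Countable (Lam N))
  exact (isInducing_toContinuousMap_K N).secondCountableTopology

local instance (N : ℕ) [NeZero N] : TopologicalSpace.MetrizableSpace (K N) :=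
  TopologicalSpace.metrizableSpace_of_t3_secondCountable _

section Ev

variable {N : ℕ}

theorem K_ext {χ χ' : K N} (h : ∀ lam, ev χ lam = ev χ' lam) : χ = χ' :=
  PontryaginDual.ext fun a => h a.toAdd

theorem ev_add (χ : K N) (a b : Lam N) : ev χ (a + b) = ev χ a * ev χ b := map_mul χ _ _

theorem ev_zero (χ : K N) : ev χ 0 = 1 := map_one χ

theorem ev_neg (χ : K N) (a : Lam N) : ev χ (-a) = (ev χ a)⁻¹ := map_inv χ _

theorem ev_zsmul (χ : K N) (n : ℤ) (a : Lam N) : ev χ (n * a) = ev χ a ^ n := by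
  rw [← zsmul_eq_mul]
  exact map_zpow χ (Multiplicative.ofAdd a) n

theorem continuous_ev (lam : Lam N) : Continuous fun χ : K N => ev χ lam := by
  have h : Continuous fun χ : Multiplicative (Lam N) →ₜ* Circle =>
    χ (Multiplicative.ofAdd lam) := continuous_eval_const _
  exact h

/-- The element of `K_N` given by a character of `Λ_N`. -/
def mkK (f : Multiplicative (Lam N) →* Circle) : K N :=
  (⟨f, continuous_of_discreteTopology⟩ : Multiplicative (Lam N) →ₜ* Circle)

/-- The compact-open topology is tested by joint continuity in the point and the group element; as
`Λ_N` is discrete, this can be checked one element at a time. -/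
theorem continuous_to_K {X : Type*} [TopologicalSpace X] (f : X → K N)
    (h : ∀ lam, Continuous fun x => ev (f x) lam) : Continuous f := by
  rw [(isInducing_toContinuousMap_K N).continuous_iff]
  refine ContinuousMap.continuous_of_continuous_uncurry _ ?_
  rw [continuous_iff_continuousAt]
  rintro ⟨x, a⟩
  rw [ContinuousAt, nhds_prod_eq, nhds_discrete (Multiplicative (Lam N)), prod_pure, tendsto_map'_iff]
  exact (h a.toAdd).tendsto x

/-- The coordinate `χ ↦ χ(1 / N ^ k)`. -/
def proj (k : ℕ) : C(K N, Circle) := ⟨fun χ => ev χ (frac N 1 k), continuous_ev _⟩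

theorem proj_apply (k : ℕ) (χ : K N) : proj k χ = ev χ (frac N 1 k) := rfl

theorem proj_zero (χ : K N) : proj 0 χ = ev χ 1 := by
  rw [proj_apply, frac_zero_right, Int.cast_one]

theorem ev_frac (χ : K N) (n : ℤ) (k : ℕ) : ev χ (frac N n k) = proj k χ ^ n := by
  rw [proj_apply, ← ev_zsmul, ← frac_zero_right, frac_mul, mul_one, zero_add]

theorem proj_add_pow [NeZero N] (k d : ℕ) (χ : K N) : proj (k + d) χ ^ N ^ d = proj k χ := by
  rw [proj_apply k, ← frac_add_pow N 1 k d, ev_frac, one_mul]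
  exact_mod_cast rfl

theorem eK_frac (n : ℤ) (k : ℕ) : eK N (frac N n k) = (e n).comp (proj k) := by
  ext χ
  exact congrArg (fun z : Circle => (z : ℂ)) (ev_frac χ n k)

theorem eK_apply (lam : Lam N) (χ : K N) : eK N lam χ = (ev χ lam : ℂ) := rfl

theorem eK_mul (a b : Lam N) : eK N a * eK N b = eK N (a + b) := by
  ext χ; simp [eK_apply, ev_add]

theorem eK_zero : eK N 0 = 1 := by
  ext χ; simp [eK_apply, ev_zero]

theorem star_eK (a : Lam N) : star (eK N a) = eK N (-a) := by
  ext χ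
  simp only [ContinuousMap.star_apply, eK_apply, ev_neg, Circle.coe_inv_eq_conj]
  rfl

theorem span_eK : (Submodule.span ℂ (Set.range (eK N))).topologicalClosure = ⊤ := by
  refine span_topologicalClosure_eq_top (eK N) ⟨0, eK_zero⟩ (fun i j => ⟨_, eK_mul i j⟩)
    (fun i => ⟨_, star_eK i⟩) fun x y hxy => ?_
  by_contra! h
  exact hxy (K_ext fun lam => Circle.ext (h lam))

theorem range_eK_frac [NeZero N] :
    (Set.range fun p : ℤ × ℕ => eK N (frac N p.1 p.2)) = Set.range (eK N) := by
  refine Set.Subset.antisymm ?_ ?_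
  · rintro _ ⟨p, rfl⟩; exact ⟨_, rfl⟩
  · rintro _ ⟨lam, rfl⟩
    obtain ⟨n, k, rfl⟩ := exists_frac N lam
    exact ⟨(n, k), rfl⟩

theorem natCast_mul_frac [NeZero N] (n : ℤ) (k : ℕ) :
    (N : Lam N) * frac N n (k + 1) = frac N n k := by
  rw [show (N : Lam N) = ((N : ℤ) : Lam N) by push_cast; rfl, ← frac_zero_right, frac_mul,
    frac_eq_iff]
  ring

theorem natCast_mul_frac_one [NeZero N] : (N : Lam N) * frac N 1 1 = 1 := by
  rw [natCast_mul_frac, frac_zero_right, Int.cast_one]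

/-- The dual of multiplication by an element of `Λ_N`. -/
def dilate (u : Lam N) (χ : K N) : K N :=
  mkK { toFun := fun a => ev χ (u * a.toAdd)
        map_one' := by rw [toAdd_one, mul_zero, ev_zero]
        map_mul' := fun a b => by rw [toAdd_mul, mul_add, ev_add] }

theorem ev_dilate (u : Lam N) (χ : K N) (lam : Lam N) :
    ev (dilate u χ) lam = ev χ (u * lam) := rfl

variable (N) in
/-- The automorphism of `K_N` dual to multiplication by `N`. -/
def shift [NeZero N] : K N ≃ₜ K N where
  toFun := dilate N
  invFun := dilate (frac N 1 1)
  left_inv χ := K_ext fun lam => by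
    rw [ev_dilate, ev_dilate, ← mul_assoc, natCast_mul_frac_one, one_mul]
  right_inv χ := K_ext fun lam => by
    rw [ev_dilate, ev_dilate, ← mul_assoc, mul_comm (frac N 1 1), natCast_mul_frac_one, one_mul]
  continuous_toFun := continuous_to_K _ fun lam => continuous_ev _
  continuous_invFun := continuous_to_K _ fun lam => continuous_ev _

theorem ev_shift [NeZero N] (χ : K N) (lam : Lam N) :
    ev (shift N χ) lam = ev χ (N * lam) := rfl

/-- This is what makes composition with `shift` lower the level of a multiplication operator, as
conjugation by `U` must do. -/
theorem proj_succ_shift [NeZero N] (k : ℕ) (χ : K N) : proj (k + 1) (shift N χ) = proj k χ := by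
  rw [proj_apply, ev_shift, natCast_mul_frac, proj_apply]

theorem proj_zero_shift [NeZero N] (χ : K N) : proj 0 (shift N χ) = proj 0 χ ^ N := by
  rw [← proj_succ_shift 0 χ, ← proj_add_pow 0 1 (shift N χ), pow_one]

end Ev

/-! ### Covariant representations from weighted measures on `K_N` -/

local instance {H : Type*} [NormedAddCommGroup H] [InnerProductSpace ℂ H] [CompleteSpace H] :
    CStarAlgebra (H →L[ℂ] H) where

section Rep

variable {N : ℕ}

/-- `f ∈ C(𝕋)` acting on `L²(K_N, ν)` as multiplication by `f(χ(1 / N ^ k))`. -/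
def mulProj (ν : Measure (K N)) (k : ℕ) :
    C(Circle, ℂ) →⋆ₐ[ℂ] (Lp ℂ 2 ν →L[ℂ] Lp ℂ 2 ν) where
  toFun f := mulFn (f.comp (proj k)) (memLp_top_of_continuous ν (f.comp (proj k)))
  map_one' := mulFn_one _ (Eventually.of_forall fun _ => rfl)
  map_mul' f g := mulFn_mul _ _ _ (Eventually.of_forall fun _ => rfl)
  map_zero' := by
    rw [mulFn_smul (f := (1 : C(K N, ℂ))) 0 (memLp_top_of_continuous ν 1), zero_smul]
    exact Eventually.of_forall fun _ => by simp
  map_add' f g := mulFn_add _ _ _ (Eventually.of_forall fun _ => rfl)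
  commutes' c := by
    rw [mulFn_smul (f := (1 : C(K N, ℂ))) c (memLp_top_of_continuous ν 1), mulFn_one,
      Algebra.algebraMap_eq_smul_one]
    · exact Eventually.of_forall fun _ => rfl
    · exact Eventually.of_forall fun _ => by simp [Algebra.algebraMap_eq_smul_one]
  map_star' f := mulFn_star _ _ (Eventually.of_forall fun _ => rfl)

variable [NeZero N] {ν : Measure (K N)} {m : K N → ℂ}
  (hw : IsWeight ν (shift N).toMeasurableEquiv m)
include hw

theorem op_mul_mulProj_succ (k : ℕ) (f : C(Circle, ℂ)) :
    hw.op * mulProj ν (k + 1) f = mulProj ν k f * hw.op :=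
  hw.op_mul_mulFn _ _ (Eventually.of_forall fun χ => by
    change f (proj k χ) = f (proj (k + 1) (shift N χ))
    rw [proj_succ_shift])

theorem op_mul_mulProj_zero (f : C(Circle, ℂ)) :
    hw.op * mulProj ν 0 f = mulProj ν 0 (f.comp (powMap N)) * hw.op :=
  hw.op_mul_mulFn _ _ (Eventually.of_forall fun χ => by
    change f (proj 0 χ ^ N) = f (proj 0 (shift N χ))
    rw [proj_zero_shift])

/-- The representation of `𝔄_N` on `L²(K_N, ν)` given by a weight. -/
theorem exists_rep : ∃ ρ : 𝔄 N →⋆ₐ[ℂ] (Lp ℂ 2 ν →L[ℂ] Lp ℂ 2 ν),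
    (∀ f, ρ (ι N f) = mulProj ν 0 f) ∧ ρ (U N) = hw.op := by
  refine (universal N _ (mulProj ν 0) hw.op hw.op_mem_unitary fun f => ?_).exists
  rw [op_mul_mulProj_zero, mul_assoc, (Unitary.mem_iff.mp hw.op_mem_unitary).2, mul_one]

/-- Each conjugation by `U` moves the coordinate in the multiplier from `χ(1 / N ^ k)` to `χ(1 / N ^
(k + 1))`. -/
theorem rep_conjGen {ρ : 𝔄 N →⋆ₐ[ℂ] (Lp ℂ 2 ν →L[ℂ] Lp ℂ 2 ν)}
    (hι : ∀ f, ρ (ι N f) = mulProj ν 0 f) (hU : ρ (U N) = hw.op) (k : ℕ) (f : C(Circle, ℂ)) :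
    ρ (conjGen N k f) = mulProj ν k f := by
  induction k with
  | zero => simp [conjGen, hι]
  | succ k ih =>
    have : conjGen N (k + 1) f = star (U N) * conjGen N k f * U N := by
      simp only [conjGen, pow_succ (U N), pow_succ' (star (U N)), mul_assoc]
    rw [this, map_mul, map_mul, ih, map_star, hU, mul_assoc, ← op_mul_mulProj_succ, ← mul_assoc,
      (Unitary.mem_iff.mp hw.op_mem_unitary).1, one_mul]

end Rep

/-! ### The Gelfand space of `𝒜_N` -/

theorem clm_ext_e {E : Type*} [NormedAddCommGroup E] [NormedSpace ℂ E]
    {F G : C(Circle, ℂ) →L[ℂ] E} (h : ∀ n, F (e n) = G (e n)) : F = G := by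
  refine ContinuousLinearMap.ext_on (s := Set.range e) ?_ ?_
  · rw [dense_iff_closure_eq, ← Submodule.topologicalClosure_coe, span_e]
    rfl
  · rintro _ ⟨n, rfl⟩
    exact h n

section Char

variable (N : ℕ) [NeZero N]

/-- Counting measure is preserved by the bijection `shift`, and it gives every point positive mass,
so that point masses become vectors of `L²`. -/
theorem isWeight_count :
    IsWeight (Measure.count : Measure (K N)) (shift N).toMeasurableEquiv fun _ => 1 := by
  refine ⟨measurable_const, Eventually.of_forall fun _ => one_ne_zero, ?_⟩
  simp only [enorm_one, ENNReal.one_rpow, withDensity_const, one_smul]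
  ext s hs
  rw [Measure.map_apply (MeasurableEquiv.measurable _) hs, Measure.count_apply hs,
    Measure.count_apply (MeasurableEquiv.measurable _ hs)]
  congr 1
  exact (Set.encard_preimage_of_bijective (shift N).bijective s)

/-- Every `χ ∈ K_N` gives a character of `𝒜_N`. -/
theorem exists_character (χ : K N) : ∃ τ : 𝒜 N →ₐ[ℂ] ℂ,
    ∀ (k : ℕ) (f : C(Circle, ℂ)), τ (gen N k f) = f (proj k χ) := by
  obtain ⟨ρ, hι, hU⟩ := exists_rep (isWeight_count N)
  have hgen := rep_conjGen (isWeight_count N) hι hU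
  let δ : Lp ℂ 2 (Measure.count : Measure (K N)) :=
    indicatorConstLp 2 (measurableSet_singleton χ) (by simp) 1
  have hδ : δ =ᵐ[Measure.count] Set.indicator {χ} fun _ => (1 : ℂ) := indicatorConstLp_coeFn
  have hδδ : ⟪δ, δ⟫_ℂ = 1 := by
    rw [inner_self_eq_norm_sq_to_K, norm_indicatorConstLp two_ne_zero ENNReal.ofNat_ne_top]
    simp [Measure.real]
  -- Multiplication by this indicator is the rank-one projection onto `ℂ δ`.
  have hpm : MemLp (Set.indicator {χ} fun _ => (1 : ℂ)) ∞ (Measure.count : Measure (K N)) :=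
    memLp_top_of_bound ((measurable_const.indicator
      (measurableSet_singleton χ)).aestronglyMeasurable) 1 (Eventually.of_forall fun x => by
        by_cases hx : x = χ <;> simp [hx])
  have hp : ∀ ξ, ∃ c : ℂ, mulFn _ hpm ξ = c • δ := fun ξ => by
    refine ⟨ξ χ, mulFn_eq_of_ae hpm ?_⟩
    filter_upwards [Lp.coeFn_smul (ξ χ) δ, hδ] with x h1 h2
    rw [h1, Pi.smul_apply, h2]
    by_cases hx : x = χ <;> simp [hx]
  have hpδ : mulFn _ hpm δ = δ := mulFn_eq_of_ae hpm (by
    filter_upwards [hδ] with x h2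
    rw [h2]
    by_cases hx : x = χ <;> simp [hx])
  have hcont : Continuous ρ := AddMonoidHomClass.continuous_of_bound ρ 1 fun a => by
      simpa using NonUnitalStarAlgHom.norm_apply_le ρ a
  -- The generators of `𝒜 N` act by multiplication operators and so commute with the projection;
  -- this passes to the closed subalgebra and makes `δ` a joint eigenvector. The character is its
  -- eigenvalue.
  have hcomm : 𝒜 N ≤ (StarSubalgebra.centralizer ℂ {mulFn _ hpm}).comap ρ := by
    refine 𝒜_le N _ ?_ fun k f => ?_
    · rw [StarSubalgebra.coe_comap, StarSubalgebra.coe_centralizer]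
      exact (Set.isClosed_centralizer _).preimage hcont
    · rw [StarSubalgebra.mem_comap, StarSubalgebra.mem_centralizer_iff, hgen]
      rintro _ rfl
      have h1 : star (mulFn _ hpm) = mulFn _ hpm := (mulFn_star hpm hpm (Eventually.of_forall
        fun x => by by_cases hx : x = χ <;> simp [hx])).symm
      have h2 : mulFn _ hpm * mulProj Measure.count k f =
          mulProj Measure.count k f * mulFn _ hpm :=
        (mulFn_mul _ _ (memLp_top_mul (memLp_top_of_continuous _ (f.comp (proj k))) hpm)
          (Eventually.of_forall fun _ => mul_comm _ _)).symm.trans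
          (mulFn_mul _ _ _ (Eventually.of_forall fun _ => rfl))
      rw [h1]
      exact ⟨h2, h2⟩
  have heig : ∀ a : 𝒜 N, ρ (a : 𝔄 N) δ = ⟪δ, ρ (a : 𝔄 N) δ⟫_ℂ • δ := fun a => by
    have h1 : mulFn _ hpm * ρ (a : 𝔄 N) = ρ (a : 𝔄 N) * mulFn _ hpm :=
      (((StarSubalgebra.mem_centralizer_iff ℂ).mp (hcomm a.2)) _ rfl).1
    obtain ⟨c, hc⟩ := hp (ρ (a : 𝔄 N) δ)
    have h2 : ρ (a : 𝔄 N) δ = c • δ := by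
      rw [← hc]
      change _ = (mulFn _ hpm * ρ (a : 𝔄 N)) δ
      rw [h1]
      change _ = ρ (a : 𝔄 N) (mulFn _ hpm δ)
      rw [hpδ]
    rw [h2, inner_smul_right, hδδ, mul_one]
  refine ⟨⟨⟨⟨⟨fun a => ⟪δ, ρ (a : 𝔄 N) δ⟫_ℂ, ?_⟩, ?_⟩, ?_, ?_⟩, ?_⟩, ?_⟩
  · change ⟪δ, ρ 1 δ⟫_ℂ = 1
    rw [map_one]; exact hδδ
  · intro a b
    change ⟪δ, ρ ((a : 𝔄 N) * (b : 𝔄 N)) δ⟫_ℂ = ⟪δ, ρ (a : 𝔄 N) δ⟫_ℂ * ⟪δ, ρ (b : 𝔄 N) δ⟫_ℂ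
    rw [map_mul]
    change ⟪δ, ρ (a : 𝔄 N) (ρ (b : 𝔄 N) δ)⟫_ℂ = _
    rw [heig b, map_smul, inner_smul_right, mul_comm, ← heig b]
  · change ⟪δ, ρ 0 δ⟫_ℂ = 0
    rw [map_zero, zero_apply, inner_zero_right]
  · intro a b
    change ⟪δ, ρ ((a : 𝔄 N) + (b : 𝔄 N)) δ⟫_ℂ = ⟪δ, ρ (a : 𝔄 N) δ⟫_ℂ + ⟪δ, ρ (b : 𝔄 N) δ⟫_ℂ
    rw [map_add, add_apply, inner_add_right]
  · intro c
    change ⟪δ, ρ (algebraMap ℂ (𝔄 N) c) δ⟫_ℂ = c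
    rw [AlgHomClass.commutes, Algebra.algebraMap_eq_smul_one, smul_apply, inner_smul_right]
    change c * ⟪δ, δ⟫_ℂ = c
    rw [hδδ, mul_one]
  · intro k f
    change ⟪δ, ρ (conjGen N k f) δ⟫_ℂ = f (proj k χ)
    have : mulProj Measure.count k f δ = f (proj k χ) • δ := mulFn_eq_of_ae _ (by
      filter_upwards [Lp.coeFn_smul (f (proj k χ)) δ, hδ] with x h1 h2
      rw [h1, Pi.smul_apply, h2]
      by_cases hx : x = χ <;> simp [hx])
    rw [hgen, this, inner_smul_right, hδδ, mul_one]

/-- The point of `K_N` given by a character of `𝒜_N`. -/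
def charToK (τ : WeakDual.characterSpace ℂ (𝒜 N)) : K N :=
  mkK
    { toFun := fun a => ⟨τ (expHom N a), by
        obtain ⟨n, k, h⟩ := exists_frac N a.toAdd
        have h1 : a = Multiplicative.ofAdd (frac N n k) := h
        have h2 : τ (star (gen N k (e n)) * gen N k (e n)) = 1 := by
          rw [star_gen_e_mul, map_one]
        rw [map_mul, map_star, RCLike.star_def, ← Complex.normSq_eq_conj_mul_self] at h2
        rw [h1, expHom_frac]
        refine mem_sphere_zero_iff_norm.mpr ?_
        have h3 : Complex.normSq (τ (gen N k (e n))) = 1 := by exact_mod_cast h2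
        rw [Complex.normSq_eq_norm_sq] at h3
        exact (pow_eq_one_iff_of_nonneg (norm_nonneg _) two_ne_zero).mp h3⟩
      map_one' := Circle.ext (by
        change τ (expHom N 1) = 1
        rw [map_one, map_one])
      map_mul' := fun a b => Circle.ext (by
        change τ (expHom N (a * b)) = τ (expHom N a) * τ (expHom N b)
        rw [map_mul, map_mul]) }

theorem ev_charToK (τ : WeakDual.characterSpace ℂ (𝒜 N)) (lam : Lam N) :
    (ev (charToK N τ) lam : ℂ) = τ (expHom N (Multiplicative.ofAdd lam)) := rfl

theorem ev_charToK_frac (τ : WeakDual.characterSpace ℂ (𝒜 N)) (n : ℤ) (k : ℕ) :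
    (ev (charToK N τ) (frac N n k) : ℂ) = τ (gen N k (e n)) := by
  rw [ev_charToK, expHom_frac]

/-- Both sides are continuous and linear in `f`, and they agree on the exponentials by the
construction of the point of `K N`. -/
theorem character_gen (τ : WeakDual.characterSpace ℂ (𝒜 N)) (k : ℕ) (f : C(Circle, ℂ)) :
    τ (gen N k f) = f (proj k (charToK N τ)) := by
  have hc : Continuous (genHom N k) := AddMonoidHomClass.continuous_of_bound (genHom N k) 1
    fun a => by simpa using NonUnitalStarAlgHom.norm_apply_le (genHom N k) a
  let F : C(Circle, ℂ) →L[ℂ] ℂ := (WeakDual.CharacterSpace.toCLM τ).comp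
    ⟨(genHom N k).toAlgHom.toLinearMap, hc⟩
  let G : C(Circle, ℂ) →L[ℂ] ℂ := ContinuousMap.evalCLM ℂ (proj k (charToK N τ))
  have : F = G := clm_ext_e fun n => by
    change τ (gen N k (e n)) = e n (proj k (charToK N τ))
    rw [← ev_charToK_frac, ev_frac]
    rfl
  exact DFunLike.congr_fun this f

theorem charToK_injective : Function.Injective (charToK N) := by
  intro τ τ' h
  let t : 𝒜 N →⋆ₐ[ℂ] ℂ := (τ : 𝒜 N →⋆ₐ[ℂ] ℂ)
  let t' : 𝒜 N →⋆ₐ[ℂ] ℂ := (τ' : 𝒜 N →⋆ₐ[ℂ] ℂ)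
  have key : t = t' := by
    refine StarAlgHom.ext_topologicalClosure (S := StarAlgebra.adjoin ℂ
      {a | ∃ (i : ℕ) (f : C(Circle, ℂ)), a = conjGen N i f}) ?_ ?_ ?_
    · exact (WeakDual.CharacterSpace.toCLM τ).continuous
    · exact (WeakDual.CharacterSpace.toCLM τ').continuous
    · refine StarAlgHom.ext_adjoin ?_
      rintro ⟨x, hx⟩ ⟨i, f, rfl⟩
      change τ (gen N i f) = τ' (gen N i f)
      rw [character_gen, character_gen, h]
  ext a
  exact DFunLike.congr_fun key a

theorem continuous_charToK : Continuous (charToK N) := by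
  refine continuous_to_K _ fun lam => ?_
  refine continuous_induced_rng.mpr ?_
  exact (WeakDual.eval_continuous (expHom N (Multiplicative.ofAdd lam))).comp
    continuous_subtype_val

theorem charToK_surjective : Function.Surjective (charToK N) := by
  intro χ
  obtain ⟨τ, hτ⟩ := exists_character N χ
  refine ⟨WeakDual.CharacterSpace.equivAlgHom.symm τ, K_ext fun lam => ?_⟩
  obtain ⟨n, k, rfl⟩ := exists_frac N lam
  refine Circle.ext ?_
  rw [ev_charToK_frac, ev_frac]
  exact hτ k (e n)

/-- The homeomorphism of the Gelfand space of `𝒜_N` with `K_N`. -/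
def gelfandHomeo : WeakDual.characterSpace ℂ (𝒜 N) ≃ₜ K N :=
  (continuous_charToK N).homeoOfEquivCompactToT2
    (f := Equiv.ofBijective (charToK N) ⟨charToK_injective N, charToK_surjective N⟩)

theorem gelfandHomeo_apply (τ : WeakDual.characterSpace ℂ (𝒜 N)) :
    gelfandHomeo N τ = charToK N τ := rfl

/-- The Gelfand transform as an isomorphism of `𝒜_N` with `C(K_N)`. -/
def gelfandIso : 𝒜 N ≃⋆ₐ[ℂ] C(K N, ℂ) :=
  (gelfandStarTransform (𝒜 N)).trans
    ((gelfandHomeo N).symm.compStarAlgEquiv' ℂ ℂ)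

theorem gelfandIso_apply (a : 𝒜 N) (τ : WeakDual.characterSpace ℂ (𝒜 N)) :
    gelfandIso N a (gelfandHomeo N τ) = τ a := by
  change (gelfandStarTransform (𝒜 N) a) ((gelfandHomeo N).symm (gelfandHomeo N τ)) = τ a
  rw [Homeomorph.symm_apply_apply]
  rfl

theorem gelfandIso_gen (k : ℕ) (f : C(Circle, ℂ)) :
    gelfandIso N (gen N k f) = f.comp (proj k) := by
  ext χ
  obtain ⟨τ, rfl⟩ := (gelfandHomeo N).surjective χ
  rw [gelfandIso_apply, character_gen]
  rfl

end Char

/-! ### The measure `ν` on `K_N` -/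

section Measure

variable {N : ℕ}

/-- The one-parameter subgroup `lam ↦ exp (i t lam)` of `K_N`. -/
def line (t : ℝ) : K N :=
  mkK { toFun := fun a => Circle.exp (((a.toAdd.1 : ℚ) : ℝ) * t)
        map_one' := by
          have : ((1 : Multiplicative (Lam N)).toAdd.1 : ℚ) = 0 := rfl
          rw [this, Rat.cast_zero, zero_mul, Circle.exp_zero]
        map_mul' := fun a b => by
          have : ((a * b).toAdd.1 : ℚ) = a.toAdd.1 + b.toAdd.1 := rfl
          rw [this, Rat.cast_add, add_mul, Circle.exp_add] }

theorem proj_line (k : ℕ) (t : ℝ) : proj k (line t : K N) = Circle.exp (t / (N : ℝ) ^ k) := by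
  change Circle.exp (((((1 : ℤ) : ℚ) / (N : ℚ) ^ k : ℚ) : ℝ) * t) = _
  congr 1
  push_cast
  ring

theorem continuous_line : Continuous (line : ℝ → K N) :=
  continuous_to_K _ fun _ => Circle.exp.continuous.comp (continuous_const.mul continuous_id)

/-- A measurable section of `proj i`. -/
def circleSection (i : ℕ) (z : Circle) : K N := line ((N : ℝ) ^ i * Complex.arg z)

theorem measurable_circleSection (i : ℕ) : Measurable (circleSection i : Circle → K N) :=
  continuous_line.measurable.comp (measurable_const.mul measurable_arg_circle)

variable [NeZero N]

/-- A lift through coordinate `k + d` has all lower coordinates equal to the powers they must be, so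
lifted measures have the correct images at every level up to `k + d`. -/
theorem proj_circleSection (k d : ℕ) (z : Circle) :
    proj k (circleSection (k + d) z : K N) = z ^ N ^ d := by
  have hN : (N : ℝ) ≠ 0 := Nat.cast_ne_zero.mpr (NeZero.ne N)
  rw [circleSection, proj_line]
  conv_rhs => rw [← Circle.exp_arg z, circle_exp_pow]
  congr 1
  push_cast
  field_simp
  ring

/-- Positive levels suffice because coordinate `k` is the `N`-th power of coordinate `k + 1`. They
are the levels that `proj_succ_shift` can rewrite. -/
theorem measure_K_ext {μ ν : Measure (K N)} [IsFiniteMeasure μ] [IsFiniteMeasure ν]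
    (h : ∀ (k : ℕ) (f : C(Circle, ℂ)), ∫ χ, f (proj (k + 1) χ) ∂μ = ∫ χ, f (proj (k + 1) χ) ∂ν) :
    μ = ν := by
  refine measure_ext_of_span (eK N) span_eK μ ν fun lam => ?_
  obtain ⟨n, k, rfl⟩ := exists_frac N lam
  rw [← frac_add_pow N n k 1, eK_frac]
  exact h k (e (n * N ^ 1))

variable {m₀ : Circle → ℂ} (hm : MemLp m₀ ∞ haarT) {h : Circle → ℝ} (hh : Integrable h haarT)
  (h0 : ∀ᵐ z ∂haarT, 0 ≤ h z)
  (hR : ∀ᵐ z ∂haarT, ruelle N m₀ (fun w => (h w : ℂ)) z = (h z : ℂ))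
include hm hh h0 hR

/-- Level `i` is lifted to `K N` by a section of coordinate `i`. For a fixed coordinate `k` the
lifts with `i ≥ k` all have the right image, so any weak limit point does. -/
theorem exists_measure :
    ∃ ν : FiniteMeasure (K N), ∀ k, (ν : Measure (K N)).map (proj k) = level N m₀ h k := by
  have hfin := isFiniteMeasure_level N hm hh
  have hreal : ∀ (k d : ℕ) (g : C(Circle, ℝ)),
      ∫ z, g (z ^ N ^ d) ∂(level N m₀ h (k + d)) = ∫ z, g z ∂(level N m₀ h k) := by
    intro k d g
    have := integral_pow_level N hm hh h0 hR k d (f := fun z => (g z : ℂ))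
      (memLp_top_of_continuous haarT ⟨_, Complex.continuous_ofReal.comp g.continuous⟩)
    rw [integral_complex_ofReal, integral_complex_ofReal] at this
    exact_mod_cast this
  let ν' : ℕ → FiniteMeasure (K N) := fun i =>
    ⟨(level N m₀ h i).map (circleSection i), Measure.isFiniteMeasure_map _ _⟩
  have hint : ∀ (k d : ℕ) (g : C(Circle, ℝ)),
      ∫ χ, g (proj k χ) ∂(ν' (k + d) : Measure (K N)) = ∫ z, g z ∂(level N m₀ h k) := by
    intro k d g
    change ∫ χ, g (proj k χ) ∂((level N m₀ h (k + d)).map (circleSection (k + d))) = _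
    have hg : Continuous fun χ : K N => g (proj k χ) := g.continuous.comp (proj k).continuous
    rw [integral_map (measurable_circleSection _).aemeasurable hg.aestronglyMeasurable]
    simp only [proj_circleSection]
    exact hreal k d g
  -- The constant function `1` shows that the masses agree, which puts all lifts in one weakly
  -- compact set of measures.
  have hmass : ∀ i, (ν' i).mass = (ν' 0).mass := by
    intro i
    have h1 := hint 0 i 1
    have h2 := hint 0 0 1
    rw [zero_add] at h1
    simp only [ContinuousMap.one_apply, integral_const, smul_eq_mul, mul_one] at h1 h2
    have h3 := h1.trans h2.symm
    exact NNReal.coe_injective h3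
  obtain ⟨ν, -, hν⟩ := isCompact_iff_ultrafilter_le_nhds.mp
    (isCompact_setOfPred_finiteMeasure_le_of_compactSpace (K N) (ν' 0).mass)
    ((hyperfilter ℕ).map ν') (by
      rw [Ultrafilter.coe_map, le_principal_iff]
      exact Eventually.of_forall (f := (hyperfilter ℕ : Filter ℕ)) fun i => (hmass i).le)
  have hν : Tendsto ν' (hyperfilter ℕ : Filter ℕ) (nhds ν) := hν
  rw [FiniteMeasure.tendsto_iff_forall_integral_tendsto] at hν
  refine ⟨ν, fun k => ?_⟩
  refine ext_of_forall_integral_eq_of_IsFiniteMeasure fun g => ?_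
  rw [integral_map (proj k).continuous.aemeasurable g.continuous.aestronglyMeasurable]
  have h1 := hν (g.compContinuous (proj k))
  refine tendsto_nhds_unique h1 (tendsto_const_nhds.congr' ?_)
  refine Nat.hyperfilter_le_atTop ?_
  filter_upwards [eventually_ge_atTop k] with i hi
  obtain ⟨d, rfl⟩ := Nat.exists_eq_add_of_le hi
  exact (hint k d g.toContinuousMap).symm

end Measure

/-! ### The weight on `K_N` defined by `m₀` -/

section Weight

variable {N : ℕ} {m₀ : Circle → ℂ} {h : Circle → ℝ} {ν : Measure (K N)}

theorem quasiMeasurePreserving_proj (hν : ∀ k, ν.map (proj k) = level N m₀ h k) (k : ℕ) :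
    Measure.QuasiMeasurePreserving (proj k) ν haarT :=
  ⟨(proj k).continuous.measurable, by
    rw [hν]; exact level_absolutelyContinuous N m₀ h k⟩

theorem memLp_top_comp_proj (hν : ∀ k, ν.map (proj k) = level N m₀ h k) (k : ℕ) {f : Circle → ℂ}
    (hf : MemLp f ∞ haarT) : MemLp (fun χ => f (proj k χ)) ∞ ν := by
  refine ⟨hf.1.comp_quasiMeasurePreserving (quasiMeasurePreserving_proj hν k), ?_⟩
  have h1 : MemLp f ∞ (level N m₀ h k) := by
    refine ⟨hf.1.mono_ac (level_absolutelyContinuous N m₀ h k), ?_⟩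
    rw [eLpNorm_exponent_top]
    exact (eLpNormEssSup_mono_measure f (level_absolutelyContinuous N m₀ h k)).trans_lt
      (by simpa using hf.2)
  have h2 := h1.2
  rw [← hν k, eLpNorm_map_measure (by rw [hν k]; exact h1.1)
    (proj k).continuous.aemeasurable] at h2
  exact h2

theorem integral_comp_proj (hν : ∀ k, ν.map (proj k) = level N m₀ h k) (k : ℕ) {f : Circle → ℂ}
    (hf : AEStronglyMeasurable f haarT) :
    ∫ χ, f (proj k χ) ∂ν = ∫ z, f z ∂(level N m₀ h k) := by
  rw [← hν k, integral_map (proj k).continuous.aemeasurable]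
  rw [hν k]
  exact hf.mono_ac (level_absolutelyContinuous N m₀ h k)

/-- Test on functions of coordinate `k + 1`. After `shift` they depend on coordinate `k`, whose law
has density `|m₀⁽ᵏ⁾|² h`; the weight adds the factor `|m₀(z ^ (N ^ k))|²`, and the product is the
density at level `k + 1`. -/
theorem isWeight_of_level [NeZero N] [IsFiniteMeasure ν] (hm : MemLp m₀ ∞ haarT) (hmm : Measurable m₀)
    (hm0 : ∀ᵐ z ∂haarT, m₀ z ≠ 0) (hh : Integrable h haarT) (h0 : ∀ᵐ z ∂haarT, 0 ≤ h z)
    (hν : ∀ k, ν.map (proj k) = level N m₀ h k) :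
    IsWeight ν (shift N).toMeasurableEquiv fun χ => m₀ (proj 0 χ) := by
  have hmeas : Measurable fun χ : K N => m₀ (proj 0 χ) :=
    hmm.comp (proj 0).continuous.measurable
  refine ⟨hmeas, (quasiMeasurePreserving_proj hν 0).ae hm0, ?_⟩
  have hd : Measurable fun χ : K N => ‖m₀ (proj 0 χ)‖ₑ ^ (2 : ℝ) := hmeas.enorm.pow_const _
  have hmem : MemLp (fun χ : K N => m₀ (proj 0 χ)) 2 ν :=
    (memLp_top_comp_proj hν 0 hm).mono_exponent le_top
  have hfin : IsFiniteMeasure (ν.withDensity fun χ => ‖m₀ (proj 0 χ)‖ₑ ^ (2 : ℝ)) := by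
    refine isFiniteMeasure_withDensity ?_
    have := (eLpNorm_lt_top_iff_lintegral_rpow_enorm_lt_top two_ne_zero
      ENNReal.ofNat_ne_top).mp hmem.2
    exact this.ne
  have hfin' := Measure.isFiniteMeasure_map (ν.withDensity fun χ => ‖m₀ (proj 0 χ)‖ₑ ^ (2 : ℝ))
    (shift N).toMeasurableEquiv
  refine measure_K_ext fun k f => ?_
  rw [integral_map_equiv, integral_withDensity_eq_integral_toReal_smul hd
    (Eventually.of_forall fun x => by finiteness)]
  have h1 : ∀ χ : K N, (‖m₀ (proj 0 χ)‖ₑ ^ (2 : ℝ)).toReal •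
      f (proj (k + 1) ((shift N).toMeasurableEquiv χ)) =
      ((‖m₀ (proj k χ ^ N ^ k)‖ ^ 2 : ℝ) : ℂ) * f (proj k χ) := by
    intro χ
    have h2 : proj k χ ^ N ^ k = proj 0 χ := by
      have := proj_add_pow 0 k χ
      rwa [zero_add] at this
    change _ • f (proj (k + 1) (shift N χ)) = _
    rw [proj_succ_shift, h2, ← ENNReal.toReal_rpow, toReal_enorm, Real.rpow_two,
      Complex.real_smul]
  simp_rw [h1]
  have hf := (memLp_top_of_continuous haarT f)
  have hmk := memLp_top_normSq (hm.comp_measurePreserving (measurePreserving_pow (N ^ k)))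
  rw [integral_comp_proj hν k
    (f := fun z => ((‖m₀ (z ^ N ^ k)‖ ^ 2 : ℝ) : ℂ) * f z) (memLp_top_mul hmk hf).1,
    integral_comp_proj hν (k + 1) hf.1, integral_level N hm hh h0, integral_level N hm hh h0]
  refine integral_congr_ae (Eventually.of_forall fun z => ?_)
  simp only [cocycle_succ, norm_mul, mul_pow, Complex.ofReal_mul]
  ring

end Weight

/-! ### The induced representation on `L²(K_N, ν)` -/

section Concrete

variable {N : ℕ} {m₀ : LInf} {h : Circle → ℝ} {ν : FiniteMeasure (K N)}

theorem eL2_coe (lam : Lam N) : eL2 ν lam =ᵐ[(ν : Measure (K N))] eK N lam :=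
  ContinuousMap.coeFn_toLp (𝕜 := ℂ) (p := 2) (ν : Measure (K N)) (eK N lam)

theorem one_coe : ContinuousMap.toLp 2 (ν : Measure (K N)) ℂ 1 =ᵐ[(ν : Measure (K N))]
    fun _ => (1 : ℂ) :=
  ContinuousMap.coeFn_toLp (𝕜 := ℂ) (p := 2) (ν : Measure (K N)) (1 : C(K N, ℂ))

theorem span_eL2 [NeZero N] : (Submodule.span ℂ (Set.range fun p : ℤ × ℕ =>
    eL2 ν (frac N p.1 p.2))).topologicalClosure = ⊤ := by
  have h1 : DenseRange (ContinuousMap.toLp 2 (ν : Measure (K N)) ℂ :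
      C(K N, ℂ) →L[ℂ] Lp ℂ 2 (ν : Measure (K N))) :=
    ContinuousMap.toLp_denseRange ℂ _ ℂ ENNReal.ofNat_ne_top
  have h2 := h1.topologicalClosure_map_submodule (span_eK (N := N))
  rw [← range_eK_frac, Submodule.map_span, ← Set.range_comp] at h2
  exact h2

/-- `L^∞(𝕋)` acting on `L²(K_N, ν)` by multiplication by `f(χ(1))`. -/
def linfRep (hν : ∀ k, (ν : Measure (K N)).map (proj k) = level N m₀ h k) :
    LInfRep (Lp ℂ 2 (ν : Measure (K N))) where
  op :=
    { toFun := fun f => mulFn _ (memLp_top_comp_proj hν 0 (Lp.memLp f))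
      map_add' := fun f g => mulFn_add _ _ _
        ((quasiMeasurePreserving_proj hν 0).ae (Lp.coeFn_add f g))
      map_smul' := fun c f => mulFn_smul _ _ _
        ((quasiMeasurePreserving_proj hν 0).ae (Lp.coeFn_smul c f)) }
  map_one _ hf := mulFn_one _ ((quasiMeasurePreserving_proj hν 0).ae hf)
  map_mul _ _ _ hk := mulFn_mul _ _ _ ((quasiMeasurePreserving_proj hν 0).ae hk)
  map_star _ _ hg := mulFn_star _ _ ((quasiMeasurePreserving_proj hν 0).ae hg)

theorem linfRep_op (hν : ∀ k, (ν : Measure (K N)).map (proj k) = level N m₀ h k) (f : LInf) :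
    (linfRep hν).op f = mulFn _ (memLp_top_comp_proj hν 0 (Lp.memLp f)) := rfl

theorem linfRep_toLp (hν : ∀ k, (ν : Measure (K N)).map (proj k) = level N m₀ h k)
    (f : C(Circle, ℂ)) :
    (linfRep hν).op (ContinuousMap.toLp ∞ haarT ℂ f) = mulProj (ν : Measure (K N)) 0 f :=
  mulFn_congr _ _ ((quasiMeasurePreserving_proj hν 0).ae
    (ContinuousMap.coeFn_toLp (𝕜 := ℂ) (p := ∞) haarT f))

theorem rep_ι_eL2
    {ρ : 𝔄 N →⋆ₐ[ℂ] (Lp ℂ 2 (ν : Measure (K N)) →L[ℂ] Lp ℂ 2 (ν : Measure (K N)))}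
    (hι : ∀ f, ρ (ι N f) = mulProj (ν : Measure (K N)) 0 f) (n : ℤ) (lam : Lam N) :
    ρ (ι N (e n)) (eL2 ν lam) = eL2 ν ((n : Lam N) + lam) := by
  rw [hι]
  refine mulFn_eq_of_ae _ ?_
  filter_upwards [eL2_coe (ν := ν) lam, eL2_coe (ν := ν) ((n : Lam N) + lam)] with χ h1 h2
  rw [h1, h2, ← eK_mul, ContinuousMap.mul_apply, ← frac_zero_right, eK_frac]

variable [NeZero N] (hw : IsWeight (ν : Measure (K N)) (shift N).toMeasurableEquiv
    fun χ => m₀ (proj 0 χ))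
  {ρ : 𝔄 N →⋆ₐ[ℂ] (Lp ℂ 2 (ν : Measure (K N)) →L[ℂ] Lp ℂ 2 (ν : Measure (K N)))}
  (hι : ∀ f, ρ (ι N f) = mulProj (ν : Measure (K N)) 0 f) (hU : ρ (U N) = hw.op)
include hU

theorem rep_U_eL2 (n : ℤ) (k : ℕ) :
    ∀ᵐ χ ∂(ν : Measure (K N)), ρ (U N) (eL2 ν (frac N n (k + 1))) χ =
      m₀ (ev χ 1) * eK N (frac N n k) χ := by
  rw [hU]
  filter_upwards [hw.op_coe (eL2 ν (frac N n (k + 1))),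
    hw.quasi.ae (eL2_coe (ν := ν) (frac N n (k + 1)))] with χ h1 h2
  rw [h1, h2, proj_zero]
  congr 1
  change ((ev (shift N χ) (frac N n (k + 1)) : Circle) : ℂ) = ev χ (frac N n k)
  rw [ev_shift, natCast_mul_frac]

theorem rep_U_eL2_zero :
    ∀ᵐ χ ∂(ν : Measure (K N)), ρ (U N) (eL2 ν 0) χ = m₀ (ev χ 1) := by
  have h0 : ∀ k, frac N 0 k = 0 := fun k =>
    Subtype.ext (by change ((0 : ℤ) : ℚ) / (N : ℚ) ^ k = 0; simp)
  have := rep_U_eL2 hw hU 0 0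
  rw [h0, h0] at this
  filter_upwards [this] with χ hχ
  rw [hχ, eK_zero, ContinuousMap.one_apply, mul_one]

include hι

/-- Realizes every `e(n / N ^ k)` inside the orbit of `1`, so that cyclicity follows from the
density of these vectors. -/
theorem conjGen_e_one (n : ℤ) (k : ℕ) : ρ (conjGen N k (e n))
    (ContinuousMap.toLp 2 (ν : Measure (K N)) ℂ 1) = eL2 ν (frac N n k) := by
  rw [rep_conjGen hw hι hU]
  refine mulFn_eq_of_ae _ ?_
  filter_upwards [eL2_coe (ν := ν) (frac N n k), one_coe (ν := ν)] with χ h1 h2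
  rw [h1, h2, eK_frac, mul_one]

theorem isInduced_linfRep (hh : Integrable h haarT) (h0 : ∀ᵐ z ∂haarT, 0 ≤ h z)
    (hν : ∀ k, (ν : Measure (K N)).map (proj k) = level N m₀ h k) :
    IsInduced N m₀ h ρ (linfRep hν) (ContinuousMap.toLp 2 (ν : Measure (K N)) ℂ 1) where
  extends_rep f := by rw [linfRep_toLp, hι]
  covariant f g hfg := by
    rw [hU]
    refine hw.op_mul_mulFn _ _ ?_
    filter_upwards [(quasiMeasurePreserving_proj hν 0).ae hfg] with χ hχ
    rw [hχ, ← proj_zero_shift]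
    rfl
  moments f := by
    have h1 : ⟪(ContinuousMap.toLp 2 (ν : Measure (K N)) ℂ 1 : Lp ℂ 2 (ν : Measure (K N))),
        (linfRep hν).op f (ContinuousMap.toLp 2 (ν : Measure (K N)) ℂ 1)⟫_ℂ =
        ∫ χ, f (proj 0 χ) ∂(ν : Measure (K N)) := by
      rw [L2.inner_def]
      refine integral_congr_ae ?_
      filter_upwards [one_coe (ν := ν), mulFn_coe _ (memLp_top_comp_proj hν 0 (Lp.memLp f))
        (ContinuousMap.toLp 2 (ν : Measure (K N)) ℂ 1)] with χ h1 h2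
      rw [linfRep_op, h2, h1]
      simp
    rw [h1, integral_comp_proj hν 0 (Lp.aestronglyMeasurable f),
      integral_level N (Lp.memLp m₀) hh h0]
    simp
  scaling := by
    rw [hU]
    refine (mulFn_eq_of_ae _ ?_).symm
    filter_upwards [hw.op_coe (ContinuousMap.toLp 2 (ν : Measure (K N)) ℂ 1),
      hw.quasi.ae (one_coe (ν := ν)), one_coe (ν := ν)] with χ h1 h2 h3
    rw [h1, h2, h3]
  cyclic := by
    refine top_le_iff.mp ?_
    rw [← span_eL2 (ν := ν)]
    refine Submodule.topologicalClosure_mono (Submodule.span_mono ?_)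
    rintro _ ⟨p, rfl⟩
    exact ⟨conjGen N p.2 (e p.1), conjGen_e_one hw hι hU p.1 p.2⟩

end Concrete

/-! ### Uniqueness of the induced representation -/

/-- The product of two classes in `L^∞(𝕋)`. -/
def mulL (f g : LInf) : LInf := (memLp_top_mul (Lp.memLp f) (Lp.memLp g)).toLp

theorem mulL_coe (f g : LInf) : ∀ᵐ z ∂haarT, mulL f g z = f z * g z := MemLp.coeFn_toLp
  (memLp_top_mul (Lp.memLp f) (Lp.memLp g))

/-- The conjugate of a class in `L^∞(𝕋)`. -/
def starL (f : LInf) : LInf := (Lp.memLp f).star.toLp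

theorem starL_coe (f : LInf) : ∀ᵐ z ∂haarT, starL f z = conj (f z) :=
  MemLp.coeFn_toLp (Lp.memLp f).star

/-- The class of `f(z ^ (N ^ d))`. -/
def powL (N : ℕ) [NeZero N] (d : ℕ) (f : LInf) : LInf :=
  ((Lp.memLp f).comp_measurePreserving (measurePreserving_pow (N ^ d))).toLp

theorem powL_coe (N : ℕ) [NeZero N] (d : ℕ) (f : LInf) :
    ∀ᵐ z ∂haarT, powL N d f z = f (z ^ N ^ d) :=
  MemLp.coeFn_toLp ((Lp.memLp f).comp_measurePreserving (measurePreserving_pow (N ^ d)))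

/-- The class of the cocycle. -/
def cocycleL (N : ℕ) [NeZero N] (m₀ : LInf) (i : ℕ) : LInf := (memLp_cocycle N (Lp.memLp m₀) i).toLp

theorem cocycleL_coe (N : ℕ) [NeZero N] (m₀ : LInf) (i : ℕ) :
    ∀ᵐ z ∂haarT, cocycleL N m₀ i z = cocycle N m₀ i z :=
  MemLp.coeFn_toLp (memLp_cocycle N (Lp.memLp m₀) i)

theorem ae_pow (N : ℕ) [NeZero N] {p : Circle → Prop} (h : ∀ᵐ z ∂haarT, p z) :
    ∀ᵐ z ∂haarT, p (z ^ N) := (measurePreserving_pow N).quasiMeasurePreserving.ae h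

theorem powL_succ (N : ℕ) [NeZero N] (d : ℕ) (f : LInf) :
    powL N (d + 1) f = powL N 1 (powL N d f) := by
  refine Lp.ext ?_
  filter_upwards [powL_coe N (d + 1) f, powL_coe N 1 (powL N d f),
    ae_pow N (p := fun z => powL N d f z = f (z ^ N ^ d)) (powL_coe N d f)] with z h1 h2 h3
  rw [h1, h2, pow_one, h3, ← pow_mul, ← pow_succ']

theorem powL_zero (N : ℕ) [NeZero N] (f : LInf) : powL N 0 f = f := by
  refine Lp.ext ?_
  filter_upwards [powL_coe N 0 f] with z h1
  rw [h1, pow_zero, pow_one]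

theorem cocycleL_succ (N : ℕ) [NeZero N] (m₀ : LInf) (i : ℕ) :
    cocycleL N m₀ (i + 1) = mulL (powL N 1 (cocycleL N m₀ i)) m₀ := by
  refine Lp.ext ?_
  filter_upwards [cocycleL_coe N m₀ (i + 1), mulL_coe (powL N 1 (cocycleL N m₀ i)) m₀,
    powL_coe N 1 (cocycleL N m₀ i), ae_pow N
      (p := fun z => cocycleL N m₀ i z = cocycle N m₀ i z) (cocycleL_coe N m₀ i)]
    with z h1 h2 h3 h4
  rw [h1, h2, h3, pow_one, h4, cocycle_succ']

theorem LInfRep.op_mulL {H : Type*} [NormedAddCommGroup H] [InnerProductSpace ℂ H]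
    [CompleteSpace H] (π : LInfRep H) (f g : LInf) : π.op (mulL f g) = π.op f * π.op g :=
  π.map_mul _ _ _ (mulL_coe f g)

section Induced

variable {N : ℕ} {m₀ : LInf} {h : Circle → ℝ} {H : Type*} [NormedAddCommGroup H]
  [InnerProductSpace ℂ H] [CompleteSpace H] {ρ : 𝔄 N →⋆ₐ[ℂ] (H →L[ℂ] H)} {π : LInfRep H} {φ : H}

/-- The vector `U⁻ⁱ π(f) Uⁱ φ`. -/
def levelVec (ρ : 𝔄 N →⋆ₐ[ℂ] (H →L[ℂ] H)) (π : LInfRep H) (φ : H) (p : ℕ × LInf) : H :=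
  ρ (star (U N) ^ p.1) (π.op p.2 (ρ (U N ^ p.1) φ))

theorem rep_star_U_pow_U_pow (ρ : 𝔄 N →⋆ₐ[ℂ] (H →L[ℂ] H)) (i : ℕ) (ξ : H) :
    ρ (star (U N) ^ i) (ρ (U N ^ i) ξ) = ξ := by
  change (ρ (star (U N) ^ i) * ρ (U N ^ i)) ξ = ξ
  rw [← map_mul, star_U_pow_mul_U_pow, map_one]; rfl

theorem rep_U_pow_star_U_pow (ρ : 𝔄 N →⋆ₐ[ℂ] (H →L[ℂ] H)) (i : ℕ) (ξ : H) :
    ρ (U N ^ i) (ρ (star (U N) ^ i) ξ) = ξ := by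
  change (ρ (U N ^ i) * ρ (star (U N) ^ i)) ξ = ξ
  rw [← map_mul, U_pow_mul_star_U_pow, map_one]; rfl

theorem inner_rep_star_U_pow (ρ : 𝔄 N →⋆ₐ[ℂ] (H →L[ℂ] H)) (i : ℕ) (ξ η : H) :
    ⟪ρ (star (U N) ^ i) ξ, ρ (star (U N) ^ i) η⟫_ℂ = ⟪ξ, η⟫_ℂ := by
  rw [← star_pow, map_star, ContinuousLinearMap.star_eq_adjoint,
    ContinuousLinearMap.adjoint_inner_left, ← ContinuousLinearMap.star_eq_adjoint, ← map_star,
    star_pow, rep_U_pow_star_U_pow]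

theorem IsInduced.inner_op (hI : IsInduced N m₀ h ρ π φ) (f g : LInf) : ⟪π.op f φ, π.op g φ⟫_ℂ =
    ∫ z, conj (f z) * g z * (h z : ℂ) ∂haarT := by
  rw [← ContinuousLinearMap.adjoint_inner_right, ← ContinuousLinearMap.star_eq_adjoint,
    ← π.map_star f _ (starL_coe f)]
  change ⟪φ, (π.op (starL f) * π.op g) φ⟫_ℂ = _
  rw [← π.op_mulL, hI.moments]
  refine integral_congr_ae ?_
  filter_upwards [starL_coe f, mulL_coe (starL f) g] with z h1 h2
  rw [h2, h1]

variable [NeZero N] (hI : IsInduced N m₀ h ρ π φ)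
include hI

namespace IsInduced

theorem U_pow_op (i : ℕ) (f : LInf) (ξ : H) :
    ρ (U N ^ i) (π.op f ξ) = π.op (powL N i f) (ρ (U N ^ i) ξ) := by
  induction i generalizing f with
  | zero => rw [powL_zero, pow_zero, map_one]; rfl
  | succ i ih =>
    have hc := hI.covariant (powL N i f) (powL N (i + 1) f) (by
      rw [powL_succ]
      filter_upwards [powL_coe N 1 (powL N i f)] with z hz
      rw [hz, pow_one])
    rw [pow_succ', map_mul]
    change ρ (U N) (ρ (U N ^ i) (π.op f ξ)) = π.op (powL N (i + 1) f) (ρ (U N) (ρ (U N ^ i) ξ))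
    rw [ih]
    exact DFunLike.congr_fun hc _

theorem op_star_U_pow (i : ℕ) (f : LInf) (ξ : H) :
    π.op f (ρ (star (U N) ^ i) ξ) = ρ (star (U N) ^ i) (π.op (powL N i f) ξ) := by
  have := hI.U_pow_op i f (ρ (star (U N) ^ i) ξ)
  rw [rep_U_pow_star_U_pow] at this
  rw [← this, rep_star_U_pow_U_pow]

/-- Covariance moves each `U` past the multiplier already obtained, and the scaling relation
converts it into one more factor `m₀`. -/
theorem U_pow_cyclic (i : ℕ) : ρ (U N ^ i) φ = π.op (cocycleL N m₀ i) φ := by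
  induction i with
  | zero =>
    rw [pow_zero, map_one, π.map_one]
    filter_upwards [cocycleL_coe N m₀ 0] with z hz
    rw [hz, cocycle_zero]
  | succ i ih =>
    have h1 := hI.U_pow_op 1 (cocycleL N m₀ i) φ
    rw [pow_one, hI.scaling] at h1
    rw [pow_succ', map_mul, cocycleL_succ, π.op_mulL]
    change ρ (U N) (ρ (U N ^ i) φ) = _
    rw [ih]
    exact h1

theorem inner_levelVec (i : ℕ) (f g : LInf) :
    ⟪levelVec ρ π φ (i, f), levelVec ρ π φ (i, g)⟫_ℂ = ∫ z,
      conj (mulL f (cocycleL N m₀ i) z) * mulL g (cocycleL N m₀ i) z * (h z : ℂ) ∂haarT := by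
  rw [← hI.inner_op, levelVec, levelVec, inner_rep_star_U_pow, hI.U_pow_cyclic, π.op_mulL,
    π.op_mulL]
  rfl

/-- The nesting of levels, now with symbols in `L^∞`: `d` copies of `U` pass through `π(f)` and
cancel against `d` copies of `U⁻¹`. -/
theorem levelVec_raise (i d : ℕ) (f : LInf) :
    levelVec ρ π φ (i + d, powL N d f) = levelVec ρ π φ (i, f) := by
  have h1 : ρ (U N ^ (i + d)) φ = ρ (U N ^ d) (ρ (U N ^ i) φ) := by
    rw [add_comm, pow_add, map_mul]; rfl
  have h2 : ∀ ξ, ρ (star (U N) ^ (i + d)) ξ = ρ (star (U N) ^ i) (ρ (star (U N) ^ d) ξ) := by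
    intro ξ
    rw [pow_add, map_mul]; rfl
  rw [levelVec, levelVec, h1, ← hI.U_pow_op, h2, rep_star_U_pow_U_pow]

/-- Both vectors are raised to level `p.1 + q.1`. The resulting Gram matrix involves only `m₀` and
`h`, not the representation. -/
theorem inner_levelVec' (p q : ℕ × LInf) :
    ⟪levelVec ρ π φ p, levelVec ρ π φ q⟫_ℂ = ∫ z,
      conj (mulL (powL N q.1 p.2) (cocycleL N m₀ (p.1 + q.1)) z) *
        mulL (powL N p.1 q.2) (cocycleL N m₀ (p.1 + q.1)) z * (h z : ℂ) ∂haarT := by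
  rw [← hI.inner_levelVec, hI.levelVec_raise, add_comm p.1, hI.levelVec_raise]

theorem op_levelVec (i : ℕ) (f g : LInf) :
    π.op g (levelVec ρ π φ (i, f)) = levelVec ρ π φ (i, mulL (powL N i g) f) := by
  rw [levelVec, levelVec, hI.op_star_U_pow, π.op_mulL]
  rfl

/-- Trades a level for a factor: `U⁻¹` of a vector at level `i` is again such a vector when its
symbol is divisible by `m₀(z ^ (N ^ i))`. -/
theorem levelVec_succ (i : ℕ) (f : LInf) : levelVec ρ π φ (i + 1, f) =
    ρ (star (U N)) (levelVec ρ π φ (i, mulL f (powL N i m₀))) := by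
  have h1 : ρ (U N ^ (i + 1)) φ = π.op (powL N i m₀) (ρ (U N ^ i) φ) := by
    rw [← hI.U_pow_op, ← hI.scaling, pow_succ, map_mul]; rfl
  rw [levelVec, levelVec, h1, pow_succ', map_mul, π.op_mulL]
  rfl

theorem U_levelVec_succ (i : ℕ) (f : LInf) : ρ (U N) (levelVec ρ π φ (i + 1, f)) =
    levelVec ρ π φ (i, mulL f (powL N i m₀)) := by
  rw [hI.levelVec_succ]
  have := rep_U_pow_star_U_pow ρ 1 (levelVec ρ π φ (i, mulL f (powL N i m₀)))
  rwa [pow_one, pow_one] at this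

end IsInduced

end Induced

/-- Bounded approximate inverses of a nonsingular function. -/
theorem exists_approx_inverse (m : LInf) (hm0 : ∀ᵐ z ∂haarT, m z ≠ 0) :
    ∃ k : ℕ → LInf, (∀ n, ∀ᵐ z ∂haarT, ‖1 - k n z * m z‖ ≤ 1) ∧
      ∀ᵐ z ∂haarT, Tendsto (fun n => 1 - k n z * m z) atTop (nhds 0) := by
  let ε : ℕ → ℝ := fun n => 1 / ((n : ℝ) + 1)
  have hε : ∀ n, 0 < ε n := fun n => by positivity
  have hmeas := (Lp.stronglyMeasurable m).measurable
  have hmem : ∀ n, MemLp (fun z => ((1 / (‖m z‖ ^ 2 + ε n) : ℝ) : ℂ)) ∞ haarT := fun n => by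
    refine memLp_top_of_bound (by fun_prop : Measurable _).aestronglyMeasurable (1 / ε n)
      (Eventually.of_forall fun z => ?_)
    have : 0 < ‖m z‖ ^ 2 + ε n := by have := hε n; positivity
    rw [Complex.norm_real, Real.norm_of_nonneg (by positivity)]
    exact one_div_le_one_div_of_le (hε n) (by linarith [sq_nonneg ‖m z‖])
  -- The approximate inverse is `conj m / (|m|² + ε)`; its denominator is at least `ε`, and the
  -- error `ε / (|m|² + ε)` lies in `[0, 1]` and tends to `0` where `m ≠ 0`.
  have hk : ∀ n, ∀ᵐ z ∂haarT, 1 - mulL ((hmem n).toLp) (starL m) z * m z =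
      ((ε n / (‖m z‖ ^ 2 + ε n) : ℝ) : ℂ) := fun n => by
    filter_upwards [mulL_coe ((hmem n).toLp) (starL m), (hmem n).coeFn_toLp, starL_coe m]
      with z h1 h2 h3
    have : 0 < ‖m z‖ ^ 2 + ε n := by have := hε n; positivity
    rw [h1, h2, h3, mul_assoc, ← Complex.normSq_eq_conj_mul_self, Complex.normSq_eq_norm_sq]
    norm_cast
    field_simp
    ring
  refine ⟨fun n => mulL ((hmem n).toLp) (starL m), fun n => ?_, ?_⟩
  · filter_upwards [hk n] with z hz
    have : 0 < ‖m z‖ ^ 2 + ε n := by have := hε n; positivity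
    rw [hz, Complex.norm_real, Real.norm_of_nonneg (by have := hε n; positivity),
      div_le_one this]
    linarith [sq_nonneg ‖m z‖]
  · filter_upwards [ae_all_iff.mpr hk, hm0] with z hz hz0
    simp only [hz]
    have h1 : Tendsto ε atTop (nhds 0) := tendsto_one_div_add_atTop_nhds_zero_nat
    have h2 : Tendsto (fun n => ε n / (‖m z‖ ^ 2 + ε n)) atTop (nhds (0 / (‖m z‖ ^ 2 + 0))) :=
      h1.div (tendsto_const_nhds.add h1) (by simpa using hz0)
    rw [zero_div] at h2
    exact_mod_cast (Complex.continuous_ofReal.tendsto 0).comp h2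

/-! ### Totality of the level vectors and the intertwining unitary -/

section Induced

variable {N : ℕ} [NeZero N] {m₀ : LInf} {h : Circle → ℝ} {H : Type*} [NormedAddCommGroup H]
  [InnerProductSpace ℂ H] [CompleteSpace H] {ρ : 𝔄 N →⋆ₐ[ℂ] (H →L[ℂ] H)} {π : LInfRep H} {φ : H}
  (hI : IsInduced N m₀ h ρ π φ)
include hI

namespace IsInduced

/-- With the bounded approximate inverses `k n` of `m`, the squared error is the integral of `|f c
(1 - k n m)|² h`, where `c` is the cocycle; dominated convergence applies with bound `|f c|² |h|`.
-/
theorem exists_levelVec_approx (hh : Integrable h haarT) (i : ℕ) (f m : LInf)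
    (hm0 : ∀ᵐ z ∂haarT, m z ≠ 0) : ∃ k : ℕ → LInf,
    Tendsto (fun n => levelVec ρ π φ (i, mulL (mulL f (k n)) m)) atTop
      (nhds (levelVec ρ π φ (i, f))) := by
  obtain ⟨k, hk1, hk2⟩ := exists_approx_inverse m hm0
  refine ⟨k, ?_⟩
  let F : ℕ → LInf := fun n => f - mulL (mulL f (k n)) m
  let c := cocycleL N m₀ i
  have hF : ∀ n, ∀ᵐ z ∂haarT, mulL (F n) c z = (f z * c z) * (1 - k n z * m z) := fun n => by
    filter_upwards [mulL_coe (F n) c, Lp.coeFn_sub f (mulL (mulL f (k n)) m),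
      mulL_coe (mulL f (k n)) m, mulL_coe f (k n)] with z h1 h2 h3 h4
    rw [h1, h2, Pi.sub_apply, h3, h4]
    ring
  have hsub : ∀ n, levelVec ρ π φ (i, mulL (mulL f (k n)) m) - levelVec ρ π φ (i, f) =
      -levelVec ρ π φ (i, F n) := fun n => by
    simp only [levelVec, F, map_sub, sub_apply, neg_sub]
  have hbound : Integrable (fun z => ‖f z * c z‖ ^ 2 * ‖h z‖) haarT := by
    have := integrable_memLp_top_mul (memLp_top_normSq (memLp_top_mul (Lp.memLp f) (Lp.memLp c)))
      (hh.ofReal : Integrable (fun z => (h z : ℂ)) haarT)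
    refine this.norm.congr (Eventually.of_forall fun z => ?_)
    change ‖((‖f z * c z‖ ^ 2 : ℝ) : ℂ) * (h z : ℂ)‖ = _
    rw [norm_mul, Complex.norm_real, Complex.norm_real, Real.norm_of_nonneg (sq_nonneg _)]
  have hlim : Tendsto (fun n => ∫ z, conj (mulL (F n) c z) * mulL (F n) c z * (h z : ℂ) ∂haarT)
      atTop (nhds (∫ _, (0 : ℂ) ∂haarT)) := by
    refine tendsto_integral_of_dominated_convergence _ (fun n => ?_) hbound (fun n => ?_) ?_
    · exact (((Lp.aestronglyMeasurable _).star).mul (Lp.aestronglyMeasurable _)).mul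
        hh.ofReal.1
    · filter_upwards [hF n, hk1 n] with z h1 h2
      rw [norm_mul, norm_mul, RCLike.norm_conj, Complex.norm_real, h1, norm_mul, ← sq, mul_pow]
      refine mul_le_mul_of_nonneg_right ?_ (norm_nonneg _)
      exact mul_le_of_le_one_right (sq_nonneg _) (pow_le_one₀ (norm_nonneg _) h2)
    · filter_upwards [ae_all_iff.mpr hF, hk2] with z h1 h2
      simp only [h1]
      have h3 : Tendsto (fun n => f z * c z * (1 - k n z * m z)) atTop (nhds 0) := by
        simpa using h2.const_mul (f z * c z)
      have h4 := (((Complex.continuous_conj.tendsto 0).comp h3).mul h3).mul_const (h z : ℂ)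
      simpa using h4
  rw [integral_zero] at hlim
  rw [tendsto_iff_norm_sub_tendsto_zero]
  simp only [hsub, norm_neg]
  simp only [c, ← hI.inner_levelVec i, inner_self_eq_norm_sq_to_K] at hlim
  have h5 : Tendsto (fun n => ‖levelVec ρ π φ (i, F n)‖ ^ 2) atTop (nhds 0) := by
    have := (Complex.continuous_re.tendsto 0).comp hlim
    refine (this.congr fun n => ?_)
    change ((‖levelVec ρ π φ (i, F n)‖ : ℂ) ^ 2).re = _
    norm_cast
  have h6 := (Real.continuous_sqrt.tendsto 0).comp h5
  rw [Real.sqrt_zero] at h6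
  exact h6.congr fun n => Real.sqrt_sq (norm_nonneg _)

/-- The vectors `U⁻ⁱ π(f) Uⁱ φ` span a dense subspace. -/
theorem span_levelVec (hh : Integrable h haarT) (hm0 : ∀ᵐ z ∂haarT, m₀ z ≠ 0) :
    (Submodule.span ℂ (Set.range (levelVec ρ π φ))).topologicalClosure = ⊤ := by
  set M := (Submodule.span ℂ (Set.range (levelVec ρ π φ))).topologicalClosure with hM
  have hMc : IsClosed (M : Set H) := Submodule.isClosed_topologicalClosure _
  have hmem : ∀ p, levelVec ρ π φ p ∈ M := fun p =>
    Submodule.le_topologicalClosure _ (Submodule.subset_span ⟨p, rfl⟩)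
  have hinv : ∀ T : H →L[ℂ] H, (∀ p, T (levelVec ρ π φ p) ∈ M) → ∀ ξ ∈ M, T ξ ∈ M := by
    intro T hT
    have : M ≤ M.comap T.toLinearMap := by
      refine Submodule.topologicalClosure_minimal _ (Submodule.span_le.mpr ?_)
        (hMc.preimage T.continuous)
      rintro _ ⟨p, rfl⟩
      exact hT p
    exact this
  have hρc : ∀ ξ, Continuous fun a => ρ a ξ := fun ξ => by
    have h1 : Continuous ρ := AddMonoidHomClass.continuous_of_bound ρ 1 fun a => by
      simpa using NonUnitalStarAlgHom.norm_apply_le ρ a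
    exact (ContinuousLinearMap.apply ℂ H ξ).continuous.comp h1
  -- The elements leaving `M` invariant together with their adjoints form a closed star subalgebra,
  -- so it is enough to treat `C(𝕋)`, `U` and `U⁻¹`.
  let S : StarSubalgebra ℂ (𝔄 N) :=
    { carrier := {a | (∀ ξ ∈ M, ρ a ξ ∈ M) ∧ ∀ ξ ∈ M, ρ (star a) ξ ∈ M}
      mul_mem' := fun {a b} ha hb => by
        refine ⟨fun ξ hξ => ?_, fun ξ hξ => ?_⟩
        · rw [map_mul]; exact ha.1 _ (hb.1 _ hξ)
        · rw [star_mul, map_mul]; exact hb.2 _ (ha.2 _ hξ)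
      add_mem' := fun {a b} ha hb => by
        refine ⟨fun ξ hξ => ?_, fun ξ hξ => ?_⟩
        · rw [map_add]; exact M.add_mem (ha.1 _ hξ) (hb.1 _ hξ)
        · rw [star_add, map_add]; exact M.add_mem (ha.2 _ hξ) (hb.2 _ hξ)
      algebraMap_mem' := fun c => by
        refine ⟨fun ξ hξ => ?_, fun ξ hξ => ?_⟩
        · rw [AlgHomClass.commutes, Algebra.algebraMap_eq_smul_one]; exact M.smul_mem c hξ
        · rw [← algebraMap_star_comm, AlgHomClass.commutes, Algebra.algebraMap_eq_smul_one]
          exact M.smul_mem _ hξ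
      star_mem' := fun {a} ha => ⟨ha.2, by rw [star_star]; exact ha.1⟩ }
  have hS : IsClosed (S : Set (𝔄 N)) := by
    have : (S : Set (𝔄 N)) = (⋂ ξ ∈ M, (fun a => ρ a ξ) ⁻¹' M) ∩
        ⋂ ξ ∈ M, (fun a => ρ (star a) ξ) ⁻¹' M := by
      ext a
      simp only [Set.mem_inter_iff, Set.mem_iInter, Set.mem_preimage]
      rfl
    rw [this]
    exact (isClosed_biInter fun ξ _ => hMc.preimage (hρc ξ)).inter
      (isClosed_biInter fun ξ _ => hMc.preimage ((hρc ξ).comp continuous_star))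
  have hι : ∀ f, ∀ ξ ∈ M, ρ (ι N f) ξ ∈ M := fun f => hinv _ fun p => by
    rw [← hI.extends_rep, hI.op_levelVec]
    exact hmem _
  -- Raising the vector by one level first leaves a `U⁻¹` for `U` to cancel.
  have hU : ∀ ξ ∈ M, ρ (U N) ξ ∈ M := hinv _ fun p => by
    rw [← hI.levelVec_raise p.1 1 p.2, hI.U_levelVec_succ]
    exact hmem _
  -- Nonsingularity is needed here: symbols are approximated by multiples of `m₀(z ^ (N ^ i))`, on
  -- which `U⁻¹` only raises the level.
  have hU' : ∀ ξ ∈ M, ρ (star (U N)) ξ ∈ M := hinv _ fun p => by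
    obtain ⟨i, f⟩ := p
    have hp0 : ∀ᵐ z ∂haarT, powL N i m₀ z ≠ 0 := by
      filter_upwards [powL_coe N i m₀, ae_pow (N ^ i) (p := fun z => m₀ z ≠ 0) hm0] with z h1 h2
      rwa [h1]
    obtain ⟨k, hk⟩ := hI.exists_levelVec_approx hh i f _ hp0
    have := ((ρ (star (U N))).continuous.tendsto _).comp hk
    refine hMc.mem_of_tendsto this (Eventually.of_forall fun n => ?_)
    change ρ (star (U N)) (levelVec ρ π φ (i, mulL (mulL f (k n)) (powL N i m₀))) ∈ M
    rw [← hI.levelVec_succ]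
    exact hmem _
  have hall : ∀ a, a ∈ S := eq_top_of_generators_mem N S hS
    (fun f => ⟨hι f, by rw [← map_star]; exact hι _⟩) ⟨hU, hU'⟩
  have hφ : φ ∈ M := by
    have h1 : ∀ᵐ z ∂haarT, cocycleL N m₀ 0 z = 1 := cocycleL_coe N m₀ 0
    have h2 := hmem (0, cocycleL N m₀ 0)
    rw [levelVec, π.map_one _ h1] at h2
    simpa using h2
  refine top_le_iff.mp ?_
  rw [← hI.cyclic]
  refine Submodule.topologicalClosure_minimal _ (Submodule.span_le.mpr ?_) hMc
  rintro _ ⟨a, rfl⟩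
  exact (hall a).1 φ hφ

/-- Any two induced representations are unitarily equivalent. -/
theorem exists_unitary (hh : Integrable h haarT) (hm0 : ∀ᵐ z ∂haarT, m₀ z ≠ 0)
    {H' : Type} [NormedAddCommGroup H'] [InnerProductSpace ℂ H'] [CompleteSpace H']
    {ρ' : 𝔄 N →⋆ₐ[ℂ] (H' →L[ℂ] H')} {π' : LInfRep H'} {φ' : H'}
    (hI' : IsInduced N m₀ h ρ' π' φ') :
    ∃ W : H ≃ₗᵢ[ℂ] H', W φ = φ' ∧ (∀ (a : 𝔄 N) (ξ : H), W (ρ a ξ) = ρ' a (W ξ)) ∧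
      ∀ (f : LInf) (ξ : H), W (π.op f ξ) = π'.op f (W ξ) := by
  obtain ⟨W, hW⟩ := exists_linearIsometryEquiv_of_gram (levelVec ρ π φ) (levelVec ρ' π' φ')
    (hI.span_levelVec hh hm0) (hI'.span_levelVec hh hm0) fun p q => by
      rw [hI.inner_levelVec', hI'.inner_levelVec']
  have hext : ∀ (S : H →L[ℂ] H) (T : H' →L[ℂ] H'),
      (∀ p, W (S (levelVec ρ π φ p)) = T (W (levelVec ρ π φ p))) → ∀ ξ, W (S ξ) = T (W ξ) := by
    intro S T hST
    have : (W : H →L[ℂ] H').comp S = T.comp (W : H →L[ℂ] H') := by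
      refine ContinuousLinearMap.ext_on (s := Set.range (levelVec ρ π φ)) ?_ ?_
      · rw [dense_iff_closure_eq, ← Submodule.topologicalClosure_coe, hI.span_levelVec hh hm0]
        rfl
      · rintro _ ⟨p, rfl⟩
        exact hST p
    exact fun ξ => DFunLike.congr_fun this ξ
  have hπ : ∀ (f : LInf) (ξ : H), W (π.op f ξ) = π'.op f (W ξ) := fun f => hext _ _ fun p => by
    rw [hI.op_levelVec, hW, hW, hI'.op_levelVec]
  have hU : ∀ ξ : H, W (ρ (U N) ξ) = ρ' (U N) (W ξ) := hext _ _ fun p => by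
    rw [← hI.levelVec_raise p.1 1 p.2, hI.U_levelVec_succ, hW, hW, hI'.U_levelVec_succ]
  refine ⟨W, ?_, ?_, hπ⟩
  · have h1 : ∀ᵐ z ∂haarT, cocycleL N m₀ 0 z = 1 := cocycleL_coe N m₀ 0
    have h2 := hW (0, cocycleL N m₀ 0)
    rw [levelVec, levelVec, π.map_one _ h1, π'.map_one _ h1] at h2
    simpa using h2
  -- Agreement on generators extends to `𝔄 N` by the uniqueness half of `universal`. The
  -- representation is transported to `H'`, which lies in `Type` as `universal` demands.
  · let ρ₁ : 𝔄 N →⋆ₐ[ℂ] (H' →L[ℂ] H') := (StarAlgHomClass.toStarAlgHom W.conjStarAlgEquiv).comp ρ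
    have hρ₁ : ∀ a ξ, ρ₁ a ξ = W (ρ a (W.symm ξ)) := fun _ _ => rfl
    have huniq := (universal N (H' →L[ℂ] H') (ρ'.comp (ι N)) (ρ' (U N))
      (Unitary.map_mem ρ' (U_mem_unitary N)) fun f => by
        rw [← map_star]
        change ρ' (U N) * ρ' (ι N f) * ρ' (star (U N)) = ρ' (ι N (f.comp (powMap N)))
        rw [← map_mul, ← map_mul, U_cov]).unique (y₁ := ρ₁) (y₂ := ρ')
        ⟨fun f => by
          ext1 ξ
          change _ = ρ' (ι N f) ξ
          rw [hρ₁, ← hI.extends_rep, hπ, W.apply_symm_apply, hI'.extends_rep],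
        by
          ext1 ξ
          rw [hρ₁, hU, W.apply_symm_apply]⟩ ⟨fun _ => rfl, rfl⟩
    intro a ξ
    rw [← huniq, hρ₁, W.symm_apply_apply]

end IsInduced

end Induced

/-! ### Fourier series on the circle -/

/-- For `k ≠ 0`, rotation by `exp (iπ / k)` changes the sign of `e k` while Haar measure is
invariant. -/
theorem integral_e (k : ℤ) : ∫ z, e k z ∂haarT = if k = 0 then 1 else 0 := by
  split_ifs with hk
  · simp [hk]
  · have h1 := integral_mul_right_eq_self (μ := haarT) (e k) (Circle.exp (Real.pi / k))
    have h2 : ∀ z, e k (z * Circle.exp (Real.pi / k)) = -e k z := fun z => by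
      have hk' : (k : ℂ) ≠ 0 := Int.cast_ne_zero.mpr hk
      have h3 : ((Circle.exp (Real.pi / k) ^ k : Circle) : ℂ) = -1 := by
        rw [Circle.coe_zpow, Circle.coe_exp, ← Complex.exp_int_mul, ← Complex.exp_pi_mul_I]
        congr 1
        push_cast
        field_simp
      rw [e_apply, mul_zpow, Circle.coe_mul, h3, mul_neg_one, e_apply]
    simp_rw [h2] at h1
    rw [integral_neg] at h1
    exact self_eq_neg.mp h1.symm

theorem orthonormal_e :
    Orthonormal ℂ fun n : ℤ => (ContinuousMap.toLp 2 haarT ℂ (e n) : Lp ℂ 2 haarT) := by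
  classical
  rw [orthonormal_iff_ite]
  intro i j
  rw [ContinuousMap.inner_toLp]
  have h : ∀ z, e j z * conj (e i z) = e (j - i) z := fun z => by
    change e j z * (star (e i)) z = _
    rw [star_e, ← ContinuousMap.mul_apply, e_mul, sub_eq_add_neg]
  simp_rw [h, integral_e, sub_eq_zero, eq_comm]

theorem span_toLp_e : (Submodule.span ℂ (Set.range fun n : ℤ =>
    (ContinuousMap.toLp 2 haarT ℂ (e n) : Lp ℂ 2 haarT))).topologicalClosure = ⊤ := by
  have h1 : DenseRange (ContinuousMap.toLp 2 haarT ℂ : C(Circle, ℂ) →L[ℂ] Lp ℂ 2 haarT) :=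
    ContinuousMap.toLp_denseRange ℂ _ ℂ ENNReal.ofNat_ne_top
  have h2 := h1.topologicalClosure_map_submodule span_e
  rw [Submodule.map_span, ← Set.range_comp] at h2
  exact h2

theorem hasSum_fourierCoef {g : Circle → ℂ} (hg : MemLp g 2 haarT) :
    HasSum (fun j : ℤ => fourierCoef g j • (ContinuousMap.toLp 2 haarT ℂ (e j) : Lp ℂ 2 haarT))
      (hg.toLp g) := by
  have h1 := (HilbertBasis.mk orthonormal_e span_toLp_e.ge).hasSum_repr (hg.toLp g)
  simp only [HilbertBasis.repr_apply_apply, HilbertBasis.coe_mk] at h1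
  refine h1.congr_fun ?_
  intro j
  congr 1
  rw [L2.inner_def]
  refine integral_congr_ae ?_
  filter_upwards [hg.coeFn_toLp, ContinuousMap.coeFn_toLp (𝕜 := ℂ) (p := 2) haarT (e j)]
    with z h2 h3
  rw [h2, h3, ← star_e, RCLike.inner_apply, mul_comm]
  rfl

/-- The three pieces are the column, row and corner by which a square of side `M + 1` exceeds one of
side `M`, with `F` evaluated at the difference of the indices. -/
theorem sum_Icc_neg {A : Type*} [AddCommMonoid A] (F : ℤ → A) (M : ℕ) :
    ∑ j ∈ Finset.Icc (-(M : ℤ)) M, F j =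
      ∑ k ∈ Finset.range M, F (k - M) + ∑ l ∈ Finset.range M, F (M - l) + F 0 := by
  induction M with
  | zero => simp
  | succ M ih =>
    rw [Nat.cast_succ, Finset.Icc_succ_succ, Finset.sum_union (by simp),
      Finset.sum_pair (by lia), ih, Finset.sum_range_succ' (fun k : ℕ => F (k - (M + 1))),
      Finset.sum_range_succ' (fun l : ℕ => F (M + 1 - l))]
    have h1 : ∀ k : ℕ, ((k + 1 : ℕ) : ℤ) - (M + 1) = k - M := fun k => by push_cast; ring
    have h2 : ∀ k : ℕ, (M + 1 : ℤ) - ((k + 1 : ℕ) : ℤ) = M - k := fun k => by push_cast; ring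
    have h3 : ((0 : ℕ) : ℤ) - (M + 1) = -(M + 1) := by push_cast; ring
    have h4 : (M + 1 : ℤ) - ((0 : ℕ) : ℤ) = M + 1 := by push_cast; ring
    simp_rw [h1, h2, h3, h4]
    abel

theorem sum_range_sum_Icc {A : Type*} [AddCommMonoid A] (F : ℤ → A) (M : ℕ) :
    ∑ n ∈ Finset.range M, ∑ j ∈ Finset.Icc (-(n : ℤ)) n, F j =
      ∑ k ∈ Finset.range M, ∑ l ∈ Finset.range M, F (k - l) := by
  induction M with
  | zero => simp
  | succ M ih =>
    rw [Finset.sum_range_succ, ih, sum_Icc_neg, Finset.sum_range_succ]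
    simp_rw [Finset.sum_range_succ _ M]
    rw [Finset.sum_add_distrib, sub_self]
    abel

/-- Exhibits the unnormalized Fejér kernel as a square, hence nonnegative; `integral_normSq_sum_e`
gives its mass, to which only the diagonal contributes. -/
theorem normSq_sum_e (m : ℕ) (u : Circle) :
    ((‖∑ k ∈ Finset.range m, e k u‖ ^ 2 : ℝ) : ℂ) =
      ∑ k ∈ Finset.range m, ∑ l ∈ Finset.range m, e (k - l) u := by
  rw [← Complex.normSq_eq_norm_sq, ← Complex.mul_conj, map_sum, Finset.sum_mul_sum]
  refine Finset.sum_congr rfl fun k _ => Finset.sum_congr rfl fun l _ => ?_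
  change e k u * (star (e l)) u = _
  rw [star_e, ← ContinuousMap.mul_apply, e_mul, sub_eq_add_neg]

theorem e_mul_inv (j : ℤ) (z w : Circle) : e j (z * w⁻¹) = e j z * e (-j) w := by
  simp [mul_zpow]

theorem integral_normSq_sum_e (m : ℕ) (z : Circle) :
    ∫ w, ‖∑ k ∈ Finset.range m, e k (z * w⁻¹)‖ ^ 2 ∂haarT = m := by
  have hint : ∀ j : ℤ, Integrable (fun w => e j z * e (-j) w) haarT := fun j =>
    ((memLp_top_of_continuous haarT (e (-j))).integrable le_top).const_mul _
  have : ((∫ w, ‖∑ k ∈ Finset.range m, e k (z * w⁻¹)‖ ^ 2 ∂haarT : ℝ) : ℂ) = (m : ℂ) := by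
    rw [← integral_complex_ofReal]
    simp_rw [normSq_sum_e, e_mul_inv]
    rw [integral_finsetSum _ fun k _ => integrable_finsetSum _ fun l _ => hint _]
    have h1 : ∀ k ∈ Finset.range m, ∫ w, ∑ l ∈ Finset.range m,
        e ((k : ℤ) - l) z * e (-((k : ℤ) - l)) w ∂haarT = 1 := fun k hk => by
      rw [integral_finsetSum _ fun l _ => hint _]
      simp_rw [integral_const_mul, integral_e, neg_eq_zero, sub_eq_zero, Nat.cast_inj]
      rw [Finset.sum_eq_single_of_mem k hk fun l _ hl => by simp [Ne.symm hl]]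
      simp
    rw [Finset.sum_congr rfl h1]
    simp
  exact_mod_cast this

/-- The Cesàro means of the Fourier series of a bounded function obey the same bound. -/
theorem norm_sum_sum_fourierCoef_le {g : Circle → ℂ} (hg : AEStronglyMeasurable g haarT) {B : ℝ}
    (hB : ∀ᵐ z ∂haarT, ‖g z‖ ≤ B) (m : ℕ) (z : Circle) :
    ‖∑ n ∈ Finset.range m, ∑ j ∈ Finset.Icc (-(n : ℤ)) n, fourierCoef g j * e j z‖ ≤ m * B := by
  have hgi : Integrable g haarT := (memLp_top_of_bound hg B hB).integrable le_top
  have hint : ∀ j : ℤ, Integrable (fun w => e j (z * w⁻¹) * g w) haarT := fun j => by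
    refine integrable_memLp_top_mul ?_ hgi
    exact memLp_top_of_continuous haarT ((e j).comp ⟨fun w => z * w⁻¹, by fun_prop⟩)
  have h1 : ∀ j : ℤ, fourierCoef g j * e j z = ∫ w, e j (z * w⁻¹) * g w ∂haarT := fun j => by
    rw [fourierCoef, ← integral_mul_const]
    congr 1
    ext w
    rw [e_mul_inv]
    ring
  -- The sum of partial sums is convolution with a nonnegative kernel of mass `m`, so the bound `B`
  -- on `g` gives `m * B`.
  have h2 : ∑ k ∈ Finset.range m, ∑ l ∈ Finset.range m, fourierCoef g (k - l) * e (k - l) z =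
      ∫ w, ((‖∑ k ∈ Finset.range m, e k (z * w⁻¹)‖ ^ 2 : ℝ) : ℂ) * g w ∂haarT := by
    simp_rw [normSq_sum_e, Finset.sum_mul]
    rw [integral_finsetSum _ fun k _ => integrable_finsetSum _ fun l _ => hint _]
    refine Finset.sum_congr rfl fun k _ => ?_
    rw [integral_finsetSum _ fun l _ => hint _]
    exact Finset.sum_congr rfl fun l _ => h1 _
  rw [sum_range_sum_Icc fun j => fourierCoef g j * e j z, h2, ← integral_normSq_sum_e m z,
    ← integral_mul_const]
  refine norm_integral_le_of_norm_le (Integrable.mul_const ?_ _) ?_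
  · refine Continuous.integrable_of_hasCompactSupport ?_ (HasCompactSupport.of_compactSpace _)
    fun_prop
  · filter_upwards [hB] with w hw
    rw [norm_mul, Complex.norm_real, Real.norm_of_nonneg (sq_nonneg _)]
    gcongr

/-! ### Convergence in measure -/

/-- A density of finite integral has small integral over sets of small measure. -/
theorem TendstoInMeasure.withDensity {X E I : Type*} [MeasurableSpace X] [EDist E] {μ : Measure X}
    [SFinite μ] {d : X → ℝ≥0∞} (hd : ∫⁻ x, d x ∂μ ≠ ∞) {f : I → X → E} {g : X → E} {l : Filter I}
    (hf : TendstoInMeasure μ f l g) : TendstoInMeasure (μ.withDensity d) f l g := fun ε hε => by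
  simp_rw [withDensity_apply']
  exact tendsto_setLIntegral_zero hd (hf ε hε)

theorem TendstoInMeasure.comp_of_map {X Y E I : Type*} [MeasurableSpace X] [MeasurableSpace Y]
    [EDist E] {ν : Measure X} {φ : X → Y} (hφ : AEMeasurable φ ν) {f : I → Y → E} {g : Y → E}
    {l : Filter I} (hf : TendstoInMeasure (ν.map φ) f l g) :
    TendstoInMeasure ν (fun i x => f i (φ x)) l fun x => g (φ x) := fun ε hε =>
  tendsto_of_tendsto_of_tendsto_of_le_of_le tendsto_const_nhds (hf ε hε) (fun _ => zero_le)
    fun i => Measure.le_map_apply hφ {y | ε ≤ edist (f i y) (g y)}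

theorem TendstoInMeasure.mul_norm_one {X I : Type*} [MeasurableSpace X] {ν : Measure X}
    {f : I → X → ℂ} {g c : X → ℂ} {l : Filter I} (hc : ∀ x, ‖c x‖ = 1)
    (hf : TendstoInMeasure ν f l g) :
    TendstoInMeasure ν (fun i x => f i x * c x) l fun x => g x * c x := fun ε hε => by
  have h : ∀ i x, edist (f i x * c x) (g x * c x) = edist (f i x) (g x) := fun i x => by
    rw [edist_dist, edist_dist, dist_eq_norm, dist_eq_norm, ← sub_mul, norm_mul, hc, mul_one]
  simp_rw [h]
  exact hf ε hε

/-- A uniformly bounded sequence that converges in a finite measure converges in mean square. -/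
theorem tendsto_Lp_of_tendstoInMeasure_of_bound {X : Type*} [MeasurableSpace X] {ν : Measure X}
    [IsFiniteMeasure ν] {f : ℕ → Lp ℂ 2 ν} {v : Lp ℂ 2 ν} {B : ℝ}
    (hB : ∀ n, ∀ᵐ x ∂ν, ‖f n x‖ ≤ B) (hf : TendstoInMeasure ν (fun n => f n) atTop v) :
    Tendsto f atTop (nhds v) := by
  rw [Lp.tendsto_Lp_iff_tendsto_eLpNorm']
  refine tendsto_Lp_finite_of_tendstoInMeasure one_le_two ENNReal.ofNat_ne_top
    (fun n => Lp.aestronglyMeasurable _) (Lp.memLp v) ?_ hf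
  -- Truncating at height `B + 1`, strictly above the bound, leaves nothing.
  refine unifIntegrable_of one_le_two ENNReal.ofNat_ne_top
    (fun n => Lp.aestronglyMeasurable _) fun ε _ => ⟨Real.toNNReal (B + 1), fun n => ?_⟩
  have : {x | Real.toNNReal (B + 1) ≤ ‖f n x‖₊}.indicator (f n) =ᵐ[ν] 0 := by
    filter_upwards [hB n] with x hx
    refine Set.indicator_of_notMem (fun hx' => ?_) _
    have h1 : B + 1 ≤ ‖f n x‖ := Real.toNNReal_le_iff_le_coe.mp hx'
    linarith
  rw [eLpNorm_congr_ae this, eLpNorm_zero]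
  exact zero_le

/-! ### The Fourier series of `m₀` in `L²(K_N, ν)` -/

section Series

variable {N : ℕ} {ν : FiniteMeasure (K N)}

theorem norm_eK (lam : Lam N) (χ : K N) : ‖eK N lam χ‖ = 1 := Circle.norm_coe _

theorem eK_intCast_add (j : ℤ) (lam : Lam N) (χ : K N) :
    eK N ((j : Lam N) + lam) χ = e j (proj 0 χ) * eK N lam χ := by
  rw [← eK_mul, ContinuousMap.mul_apply, ← frac_zero_right, eK_frac]
  rfl

/-- The vector `p(χ(1)) e(lam)` of `L²(K_N, ν)`. -/
def trans (ν : FiniteMeasure (K N)) (lam : Lam N) : C(Circle, ℂ) →ₗ[ℂ] Lp ℂ 2 (ν : Measure (K N)) where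
  toFun p := ContinuousMap.toLp 2 (ν : Measure (K N)) ℂ (p.comp (proj 0) * eK N lam)
  map_add' p q := by rw [← map_add, ← add_mul]; rfl
  map_smul' c p := by rw [RingHom.id_apply, ← map_smul, ← smul_mul_assoc]; rfl

theorem trans_coe (lam : Lam N) (p : C(Circle, ℂ)) :
    trans ν lam p =ᵐ[(ν : Measure (K N))] fun χ => p (proj 0 χ) * eK N lam χ :=
  ContinuousMap.coeFn_toLp (𝕜 := ℂ) (p := 2) (ν : Measure (K N)) _

theorem trans_e (lam : Lam N) (j : ℤ) : trans ν lam (e j) = eL2 ν ((j : Lam N) + lam) := by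
  change ContinuousMap.toLp 2 (ν : Measure (K N)) ℂ _ = ContinuousMap.toLp 2 (ν : Measure (K N)) ℂ _
  congr 1
  ext χ
  rw [eK_intCast_add]
  rfl

end Series

section Series

variable {N : ℕ} [NeZero N] {g : Circle → ℂ} {h : Circle → ℝ} {ν : FiniteMeasure (K N)}
  (hh : Integrable h haarT) (hν : ∀ k, (ν : Measure (K N)).map (proj k) = level N g h k)

include hh hν in
theorem tendstoInMeasure_of_haarT (hg : MemLp g ∞ haarT) (lam : Lam N) {I : Type*} {l : Filter I}
    {f : I → Circle → ℂ} (hf : TendstoInMeasure haarT f l g) :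
    TendstoInMeasure (ν : Measure (K N)) (fun i χ => f i (proj 0 χ) * eK N lam χ) l
      fun χ => g (proj 0 χ) * eK N lam χ := by
  refine TendstoInMeasure.mul_norm_one (norm_eK lam) ?_
  refine TendstoInMeasure.comp_of_map (proj 0).continuous.aemeasurable ?_
  rw [hν 0]
  refine TendstoInMeasure.withDensity ?_ hf
  have := (isFiniteMeasure_level N hg hh 0).measure_univ_lt_top
  rw [level, withDensity_apply _ MeasurableSet.univ, setLIntegral_univ] at this
  exact this.ne

omit [NeZero N] in
include hν in
-- As `|e(λ)| = 1`, the error depends on `χ(1)` alone, and the law of `χ(1)` is dominated by a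
-- multiple of Haar measure.
theorem norm_trans_sub_le (hg : MemLp g ∞ haarT) {C : ℝ≥0∞} (hC : level N g h 0 ≤ C • haarT)
    (lam : Lam N) {v : Lp ℂ 2 (ν : Measure (K N))}
    (hv : v =ᵐ[(ν : Measure (K N))] fun χ => g (proj 0 χ) * eK N lam χ) (p : C(Circle, ℂ)) :
    eLpNorm (trans ν lam p - v : K N → ℂ) 2 (ν : Measure (K N)) ≤
      C ^ (1 / (2 : ℝ≥0∞)).toReal • eLpNorm (fun z => p z - g z) 2 haarT := by
  have h1 : eLpNorm (trans ν lam p - v : K N → ℂ) 2 (ν : Measure (K N)) =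
      eLpNorm ((fun z => p z - g z) ∘ proj 0) 2 (ν : Measure (K N)) := by
    refine eLpNorm_congr_norm_ae ?_
    filter_upwards [trans_coe lam p, hv] with χ h2 h3
    rw [Pi.sub_apply, h2, h3, ← sub_mul, norm_mul, norm_eK, mul_one, Function.comp_apply]
  rw [h1, ← eLpNorm_map_measure _ (proj 0).continuous.aemeasurable, hν 0]
  · exact eLpNorm_le_of_measure_le_smul hC
  · rw [hν 0]
    exact (p.continuous.aestronglyMeasurable.sub hg.1).mono_ac
      (level_absolutelyContinuous N g h 0)

/-- The partial sum over `F` of the Fourier series of `g`. -/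
def partialSum (g : Circle → ℂ) (F : Finset ℤ) : C(Circle, ℂ) := ∑ j ∈ F, fourierCoef g j • e j

theorem partialSum_apply (F : Finset ℤ) (z : Circle) :
    partialSum g F z = ∑ j ∈ F, fourierCoef g j * e j z := by
  simp [partialSum, ContinuousMap.sum_apply]

theorem tendsto_partialSum (hg : MemLp g 2 haarT) :
    Tendsto (fun F => (ContinuousMap.toLp 2 haarT ℂ (partialSum g F) : Lp ℂ 2 haarT)) atTop
      (nhds (hg.toLp g)) := by
  simp only [partialSum, map_sum, map_smul]
  exact hasSum_fourierCoef hg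

omit [NeZero N] in
theorem trans_partialSum (lam : Lam N) (F : Finset ℤ) : trans ν lam (partialSum g F) =
    ∑ j ∈ F, fourierCoef g j • eL2 ν ((j : Lam N) + lam) := by
  simp only [partialSum, map_sum, map_smul, trans_e]

/-- The Cesàro mean of the symmetric partial sums of the Fourier series of `g`. -/
def cesaroMean (g : Circle → ℂ) (M : ℕ) : C(Circle, ℂ) :=
  (M + 1 : ℂ)⁻¹ • ∑ n ∈ Finset.range (M + 1), partialSum g (Finset.Icc (-(n : ℤ)) n)

theorem tendsto_cesaroMean (hg : MemLp g 2 haarT) :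
    Tendsto (fun M => (ContinuousMap.toLp 2 haarT ℂ (cesaroMean g M) : Lp ℂ 2 haarT)) atTop
      (nhds (hg.toLp g)) := by
  -- The general Cesàro theorem averages the first `M` terms; the shift by one gives the
  -- normalization `1 / (M + 1)`.
  have h1 := (((tendsto_partialSum hg).comp (Finset.tendsto_Icc_neg (R := ℤ))).cesaro_smul).comp
    (tendsto_add_atTop_nat 1)
  refine h1.congr fun M => ?_
  simp only [Function.comp_apply, cesaroMean, map_smul, map_sum]
  rw [RCLike.real_smul_eq_coe_smul (K := ℂ)]
  push_cast
  rfl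

theorem norm_cesaroMean_le (hg : AEStronglyMeasurable g haarT) {B : ℝ}
    (hB : ∀ᵐ z ∂haarT, ‖g z‖ ≤ B) (M : ℕ) (z : Circle) : ‖cesaroMean g M z‖ ≤ B := by
  have h1 := norm_sum_sum_fourierCoef_le hg hB (M + 1) z
  have h2 : cesaroMean g M z = ((M + 1 : ℕ) : ℂ)⁻¹ * ∑ n ∈ Finset.range (M + 1),
      ∑ j ∈ Finset.Icc (-(n : ℤ)) n, fourierCoef g j * e j z := by
    simp [cesaroMean, partialSum_apply]
  have h3 : (0 : ℝ) < (M + 1 : ℕ) := by positivity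
  rw [h2, norm_mul, norm_inv, Complex.norm_natCast, inv_mul_le_iff₀ h3]
  exact h1

omit [NeZero N] in
theorem trans_cesaroMean (lam : Lam N) (M : ℕ) : trans ν lam (cesaroMean g M) =
    (M + 1 : ℂ)⁻¹ • ∑ n ∈ Finset.range (M + 1),
      ∑ j ∈ Finset.Icc (-(n : ℤ)) n, fourierCoef g j • eL2 ν ((j : Lam N) + lam) := by
  simp only [cesaroMean, map_smul, map_sum, trans_partialSum]

theorem tendstoInMeasure_of_tendsto_toLp (hg : MemLp g 2 haarT) {I : Type*} {l : Filter I}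
    {p : I → C(Circle, ℂ)} (hp : Tendsto (fun i =>
      (ContinuousMap.toLp 2 haarT ℂ (p i) : Lp ℂ 2 haarT)) l (nhds (hg.toLp g))) :
    TendstoInMeasure haarT (fun i z => p i z) l g :=
  (tendstoInMeasure_of_tendsto_Lp hp).congr
    (fun i => ContinuousMap.coeFn_toLp (𝕜 := ℂ) (p := 2) haarT (p i)) hg.coeFn_toLp

include hh hν in
theorem isFourierSum_of_ae (h0 : ∀ᵐ z ∂haarT, 0 ≤ h z) (hg : MemLp g ∞ haarT) (lam : Lam N)
    {v : Lp ℂ 2 (ν : Measure (K N))}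
    (hv : v =ᵐ[(ν : Measure (K N))] fun χ => g (proj 0 χ) * eK N lam χ) :
    IsFourierSum g h ν lam v := by
  have hg2 : MemLp g 2 haarT := hg.mono_exponent le_top
  have hpart := tendstoInMeasure_of_haarT hh hν hg lam
    (tendstoInMeasure_of_tendsto_toLp hg2 (tendsto_partialSum hg2))
  have hmeas : TendstoInMeasure (ν : Measure (K N))
      (fun F => trans ν lam (partialSum g F)) atTop v :=
    hpart.congr (fun F => (trans_coe lam _).symm) hv.symm
  refine ⟨?_, ?_, ?_⟩
  · refine hpart.congr (fun F => Eventually.of_forall fun χ => ?_) hv.symm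
    simp only [partialSum_apply, Finset.sum_mul, eK_intCast_add, mul_assoc]
  · simp_rw [← trans_cesaroMean]
    obtain ⟨B, hB⟩ : ∃ B : ℝ, ∀ᵐ z ∂haarT, ‖g z‖ ≤ B := by
      refine ⟨(eLpNorm g ∞ haarT).toReal, ?_⟩
      filter_upwards [ae_le_eLpNormEssSup (f := g) (μ := haarT)] with z hz
      rw [← toReal_enorm]
      exact ENNReal.toReal_mono hg.2.ne (by rwa [eLpNorm_exponent_top])
    -- The Fejér bound holds at every point, so no boundedness of `h` is needed to pass from measure
    -- to norm.
    refine tendsto_Lp_of_tendstoInMeasure_of_bound (B := B) (fun M => ?_) ?_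
    · filter_upwards [trans_coe lam (cesaroMean g M)] with χ h1
      rw [h1, norm_mul, norm_eK, mul_one]
      exact norm_cesaroMean_le hg.1 hB M _
    · exact (tendstoInMeasure_of_haarT hh hν hg lam
        (tendstoInMeasure_of_tendsto_toLp hg2 (tendsto_cesaroMean hg2))).congr
        (fun M => (trans_coe lam _).symm) hv.symm
  · rintro (hb | hs)
    · change Tendsto _ _ _
      simp_rw [SummationFilter.unconditional_filter, ← trans_partialSum]
      rw [Lp.tendsto_Lp_iff_tendsto_eLpNorm']
      -- At level `0` the cocycle is `1`, so the density is `h` itself.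
      have hC : level N g h 0 ≤ eLpNorm h ∞ haarT • haarT := by
        rw [← withDensity_const]
        refine withDensity_mono ?_
        filter_upwards [h0, ae_le_eLpNormEssSup (f := h) (μ := haarT)] with z h1 h2
        rw [cocycle_zero, norm_one, one_pow, one_mul, eLpNorm_exponent_top]
        rwa [Real.enorm_of_nonneg h1] at h2
      refine tendsto_of_tendsto_of_tendsto_of_le_of_le tendsto_const_nhds ?_ (fun _ => zero_le)
        fun F => norm_trans_sub_le hν hg hC lam hv (partialSum g F)
      have h1 := (Lp.tendsto_Lp_iff_tendsto_eLpNorm' _ _).mp (tendsto_partialSum hg2)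
      have h2 : ∀ F, eLpNorm (fun z => partialSum g F z - g z) 2 haarT =
          eLpNorm ((ContinuousMap.toLp 2 haarT ℂ (partialSum g F) : Lp ℂ 2 haarT) -
            (hg2.toLp g : Lp ℂ 2 haarT) : Circle → ℂ) 2 haarT := fun F =>
        eLpNorm_congr_ae ((ContinuousMap.coeFn_toLp (𝕜 := ℂ) (p := 2) haarT _).symm.sub
          hg2.coeFn_toLp.symm)
      simp_rw [h2]
      have h3 := ENNReal.Tendsto.const_mul (a := eLpNorm h ∞ haarT ^ (1 / (2 : ℝ≥0∞)).toReal) h1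
        (Or.inr (ENNReal.rpow_ne_top_of_nonneg ENNReal.toReal_nonneg hb.2.ne))
      rwa [mul_zero] at h3
    · have hsum : Summable fun j : ℤ => fourierCoef g j • eL2 ν ((j : Lam N) + lam) := by
        -- All `e(λ)` have modulus one, so the norm of the inclusion `C(K N) → L²` bounds them
        -- uniformly and absolute summability suffices.
        obtain ⟨C, hC⟩ : ∃ C : ℝ, ∀ lam : Lam N, ‖eL2 ν lam‖ ≤ C := by
          refine ⟨‖(ContinuousMap.toLp 2 (ν : Measure (K N)) ℂ :
            C(K N, ℂ) →L[ℂ] Lp ℂ 2 (ν : Measure (K N)))‖, fun lam => ?_⟩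
          refine (ContinuousLinearMap.le_opNorm _ _).trans (mul_le_of_le_one_right
            (norm_nonneg _) ?_)
          exact (ContinuousMap.norm_le _ zero_le_one).mpr fun χ => (norm_eK lam χ).le
        refine Summable.of_norm_bounded (hs.mul_right C) fun j => ?_
        rw [norm_smul]
        gcongr
        exact hC _
      obtain ⟨w, hw⟩ := hsum
      have h1 : Tendsto (fun F => trans ν lam (partialSum g F)) atTop (nhds w) := by
        simp_rw [trans_partialSum]
        exact hw
      -- The norm limit is also a limit in measure, and limits in measure are unique almost
      -- everywhere.
      have h2 : v = w := Lp.ext (tendstoInMeasure_ae_unique hmeas (tendstoInMeasure_of_tendsto_Lp h1))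
      rwa [h2]

end Series

end

end RuelleRep

/-! ### Assembling the assertions -/

theorem mainTheorem3 (N : ℕ) (hN : 2 ≤ N) :
    (∀ a b : 𝒜 N, a * b = b * a) ∧
    ∃ (Θ : WeakDual.characterSpace ℂ (𝒜 N) ≃ₜ K N) (Φ : 𝒜 N ≃⋆ₐ[ℂ] C(K N, ℂ)),
      -- the Gelfand space of `𝒜 N` is `K N`, and `Φ` is the Gelfand transform
      (∀ (τ : WeakDual.characterSpace ℂ (𝒜 N)) (n : ℤ) (k : ℕ),
        (ev (Θ τ) (frac N n k) : ℂ) = τ (gen N k (e n))) ∧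
      (∀ (a : 𝒜 N) (τ : WeakDual.characterSpace ℂ (𝒜 N)), Φ a (Θ τ) = τ a) ∧
      ∀ m₀ : LInf, (∀ᵐ z ∂haarT, m₀ z ≠ 0) →
      ∀ h : Circle → ℝ, Integrable h haarT → (∀ᵐ z ∂haarT, 0 ≤ h z) →
        (∀ᵐ z ∂haarT, ruelle N m₀ (fun w => (h w : ℂ)) z = (h z : ℂ)) →
      ∃ ν : FiniteMeasure (K N),
        -- the defining property of `ν`, and uniqueness
        (∀ (i : ℕ) (f : C(Circle, ℂ)), ∫ χ, Φ (gen N i f) χ ∂(ν : Measure (K N)) =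
          ∫ z, (ruelle N m₀)^[i] (fun w => f w * (h w : ℂ)) z ∂haarT) ∧
        (∀ ν' : FiniteMeasure (K N),
          (∀ (i : ℕ) (f : C(Circle, ℂ)), ∫ χ, Φ (gen N i f) χ ∂(ν' : Measure (K N)) =
            ∫ z, (ruelle N m₀)^[i] (fun w => f w * (h w : ℂ)) z ∂haarT) → ν' = ν) ∧
        -- the vectors `e(n / N ^ k)` span
        (Submodule.span ℂ (Set.range fun p : ℤ × ℕ =>
          eL2 ν (frac N p.1 p.2))).topologicalClosure = ⊤ ∧
        -- the `h`-induced representation on `L²(K N, ν)`, with cyclic vector `1 = e(0)`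
        ∃ (ρ : 𝔄 N →⋆ₐ[ℂ] (Lp ℂ 2 (ν : Measure (K N)) →L[ℂ] Lp ℂ 2 (ν : Measure (K N))))
          (π : LInfRep (Lp ℂ 2 (ν : Measure (K N)))),
          IsInduced N m₀ h ρ π (ContinuousMap.toLp 2 (ν : Measure (K N)) ℂ 1) ∧
          (∀ (H : Type*) [NormedAddCommGroup H] [InnerProductSpace ℂ H] [CompleteSpace H]
            (ρ' : 𝔄 N →⋆ₐ[ℂ] (H →L[ℂ] H)) (π' : LInfRep H) (φ' : H),
            IsInduced N m₀ h ρ' π' φ' →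
            ∃ W : H ≃ₗᵢ[ℂ] Lp ℂ 2 (ν : Measure (K N)),
              W φ' = ContinuousMap.toLp 2 (ν : Measure (K N)) ℂ 1 ∧
              (∀ (a : 𝔄 N) (ξ : H), W (ρ' a ξ) = ρ a (W ξ)) ∧
              ∀ (f : LInf) (ξ : H), W (π'.op f ξ) = π.op f (W ξ)) ∧
          -- the formulas for `π(e_n)` and `U`
          (∀ (n : ℤ) (lam : Lam N), ρ (ι N (e n)) (eL2 ν lam) = eL2 ν ((n : Lam N) + lam)) ∧
          (∀ (n : ℤ) (k : ℕ),
            (∀ᵐ χ ∂(ν : Measure (K N)), ρ (U N) (eL2 ν (frac N n (k + 1))) χ =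
              m₀ (ev χ 1) * eK N (frac N n k) χ) ∧
            IsFourierSum m₀ h ν (frac N n k) (ρ (U N) (eL2 ν (frac N n (k + 1))))) ∧
          (∀ᵐ χ ∂(ν : Measure (K N)), ρ (U N) (eL2 ν 0) χ = m₀ (ev χ 1)) ∧
          IsFourierSum m₀ h ν 0 (ρ (U N) (eL2 ν 0)) := by
  have : NeZero N := ⟨by omega⟩
  refine ⟨𝒜_mul_comm N, gelfandHomeo N, gelfandIso N, fun τ n k => ?_, gelfandIso_apply N, ?_⟩
  · rw [gelfandHomeo_apply, ev_charToK_frac]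
  intro m₀ hm0 h hh h0 hR
  have hm := Lp.memLp m₀
  obtain ⟨ν, hν⟩ := exists_measure hm hh h0 hR
  have hdef : ∀ (i : ℕ) (f : C(Circle, ℂ)), ∫ χ, gelfandIso N (gen N i f) χ ∂(ν : Measure (K N)) =
      ∫ z, (ruelle N m₀)^[i] (fun w => f w * (h w : ℂ)) z ∂haarT := fun i f => by
    rw [integral_iterate_ruelle_eq_level N hm hh h0, gelfandIso_gen,
      ← integral_comp_proj hν i f.continuous.aestronglyMeasurable]
    rfl
  have hw := isWeight_of_level hm (Lp.stronglyMeasurable m₀).measurable hm0 hh h0 hν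
  obtain ⟨ρ, hι, hU⟩ := exists_rep hw
  have hI := isInduced_linfRep hw hι hU hh h0 hν
  have hF : ∀ (lam : Lam N) {v : Lp ℂ 2 (ν : Measure (K N))},
      (∀ᵐ χ ∂(ν : Measure (K N)), v χ = m₀ (ev χ 1) * eK N lam χ) →
      IsFourierSum m₀ h ν lam v := fun lam v hv =>
    isFourierSum_of_ae hh hν h0 hm lam (by
      simp_rw [← proj_zero] at hv
      exact hv)
  refine ⟨ν, hdef, fun ν' hν' => ?_, span_eL2, ρ, linfRep hν, hI,
    fun H _ _ _ ρ' π' φ' hI' => IsInduced.exists_unitary hI' hh hm0 hI, rep_ι_eL2 hι,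
    fun n k => ⟨rep_U_eL2 hw hU n k, hF _ (rep_U_eL2 hw hU n k)⟩,
    rep_U_eL2_zero hw hU, hF 0 ?_⟩
  · have h1 := ν.2
    have h2 := ν'.2
    refine Subtype.ext (measure_K_ext fun k f => ?_)
    have := (hν' (k + 1) f).trans (hdef (k + 1) f).symm
    rwa [gelfandIso_gen] at this
  · filter_upwards [rep_U_eL2_zero hw hU] with χ hχ
    rw [hχ, eK_zero, ContinuousMap.one_apply, mul_one]
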